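/- Corollary (Gelfand–Kirillov conjecture for $D(q)$). Let $q(t)\in\mathbb{C}[t]$ be a polynomial of degree $n\ge 4$. Put $\rho=2q(-\tfrac12)$ and $$p(t)=\frac{-4q(t)q(-t-1)+\rho^2}{(1+2t)^2},$$ which is a polynomial, and let $p_0,p_1\in\mathbb{C}[t]$ be determined by $p(t)=p_0(t^2)+p_1(t^2)\,t$. Let $D(q)$ (the noncommutative Kleinian singularity of type $D$) be the unital associative $\mathbb{C}$-algebra with generators $u,v,w$ and defining relations $$[u,v]=2w+v,\qquad [u,w]=2vu+w+\rho,\qquad [v,w]=-v^2-p_1(u),\qquad w^2=v^2u+vw+\rho v+p_0(u),$$ where $[a,b]=ab-ba$. Let $A_1(\mathbb{C})=\mathbb{C}\langle x,\partial\rangle/(\partial x-x\partial-1)$ be the first Weyl algebra. Then $D(q)$ and $A_1(\mathbb{C})$ are (left and right) Ore domains, so that their skew fields of fractions $\operatorname{Frac} D(q)$ and $\operatorname{Frac} A_1(\mathbb{C})$ exist, and $$\operatorname{Frac} D(q)\;\cong\;\operatorname{Frac} A_1(\mathbb{C})$$ as $\mathbb{C}$-algebras. -/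

import Mathlib

open Polynomial
open scoped nonZeroDivisors

/-! ### Ore domains and their skew fields of fractions -/

/-- A (two-sided) Ore domain: a nontrivial ring without zero divisors in which any two nonzero
elements have a nonzero common left multiple and a nonzero common right multiple. -/
class IsOreDomain (R : Type*) [Ring R] : Prop extends IsDomain R where
  left_ore : ∀ r s : R, s ≠ 0 → ∃ r' s' : R, s' ≠ 0 ∧ s' * r = r' * s
  right_ore : ∀ r s : R, s ≠ 0 → ∃ r' s' : R, s' ≠ 0 ∧ r * s' = s * r'

noncomputable instance IsOreDomain.instOreSet (R : Type*) [Ring R] [IsOreDomain R] :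
    OreLocalization.OreSet R⁰ :=
  (OreLocalization.nonempty_oreSet_iff_of_noZeroDivisors.mpr fun r s => by
    obtain ⟨r', s', hs', h⟩ :=
      IsOreDomain.left_ore r (s : R) (nonZeroDivisors.ne_zero s.2)
    exact ⟨r', ⟨s', mem_nonZeroDivisors_of_ne_zero hs'⟩, h⟩).some

/-- The skew field of fractions `Frac R` of an Ore domain: the Ore localization of `R` at the set
of its nonzero elements. Mathlib provides its structure of a division ring, and that of an algebra
over any commutative ring over which `R` is an algebra. -/
abbrev SkewFrac (R : Type*) [Ring R] [IsOreDomain R] : Type _ :=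
  OreLocalization R⁰ R

/-! ### The first Weyl algebra -/

/-- The two generators of the first Weyl algebra. -/
inductive WeylGen : Type
  | x
  | d

/-- The defining relation `d x - x d = 1` of the first Weyl algebra. -/
inductive WeylRel : FreeAlgebra ℂ WeylGen → FreeAlgebra ℂ WeylGen → Prop
  | comm : WeylRel
      (FreeAlgebra.ι ℂ WeylGen.d * FreeAlgebra.ι ℂ WeylGen.x
        - FreeAlgebra.ι ℂ WeylGen.x * FreeAlgebra.ι ℂ WeylGen.d) 1

/-- The first Weyl algebra `A₁(ℂ) = ℂ⟨x, d⟩ / (d x - x d - 1)`. -/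
abbrev WeylAlgebraOne : Type := RingQuot WeylRel

/-! ### Noncommutative Kleinian singularities of type `D` -/

namespace KleinianD

/-- The constant `ρ = 2 q(-1/2)`. -/
noncomputable def rho (q : ℂ[X]) : ℂ := 2 * q.eval (-1 / 2)

/-- The numerator `-4 q(t) q(-t-1) + ρ²`. -/
noncomputable def numer (q : ℂ[X]) : ℂ[X] := -4 * q * q.comp (-X - 1) + C (rho q ^ 2)

/-- The polynomial `p(t) = (-4 q(t) q(-t-1) + ρ²) / (1 + 2t)²`. The division is exact, see
`KleinianD.p_mul`. -/
noncomputable def p (q : ℂ[X]) : ℂ[X] := numer q / (1 + 2 * X) ^ 2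

/-- The even part of `p`: `p(t) = p₀(t²) + p₁(t²) t`, see `KleinianD.p_eq`. -/
noncomputable def p0 (q : ℂ[X]) : ℂ[X] := (p q).contract 2

/-- The odd part of `p`: `p(t) = p₀(t²) + p₁(t²) t`, see `KleinianD.p_eq`. -/
noncomputable def p1 (q : ℂ[X]) : ℂ[X] := (p q).divX.contract 2

theorem p_mul (q : ℂ[X]) : p q * (1 + 2 * X) ^ 2 = numer q := by
  have hdvd : (1 + 2 * X : ℂ[X]) ^ 2 ∣ numer q := by
    obtain ⟨s, hs⟩ := X_sub_C_dvd_sub_C_eval (a := (-1 / 2 : ℂ)) (p := q)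
    have hC : (2 : ℂ[X]) * C (-1 / 2) = -1 := by
      rw [show (2 : ℂ[X]) = C 2 from rfl, ← C_mul]; norm_num
    have hq : q = C (q.eval (-1 / 2)) + (X - C (-1 / 2)) * s := by rw [← hs]; ring
    have hq' : q.comp (-X - 1)
        = C (q.eval (-1 / 2)) + (-X - 1 - C (-1 / 2)) * s.comp (-X - 1) := by
      have := congrArg (fun r : ℂ[X] => r.comp (-X - 1)) hq
      simpa using this
    have hroot : (s - s.comp (-X - 1)).IsRoot (-1 / 2) := by
      simp only [IsRoot, eval_sub, eval_comp, eval_neg, eval_X, eval_one]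
      norm_num
    obtain ⟨r, hr⟩ := dvd_iff_isRoot.mpr hroot
    refine ⟨s * s.comp (-X - 1) - C (q.eval (-1 / 2)) * r, ?_⟩
    unfold numer rho
    rw [hq']
    nth_rewrite 1 [hq]
    set a : ℂ[X] := C (q.eval (-1 / 2)) with ha
    have h4 : (C ((2 * q.eval (-1 / 2)) ^ 2) : ℂ[X]) = 4 * a ^ 2 := by
      rw [ha, mul_pow, C_mul, C_pow, C_pow]
      rw [show (C (2 : ℂ) : ℂ[X]) = 2 from rfl]; ring
    rw [h4]
    have h1 : s.comp (-X - 1) = s - (X - C (-1 / 2)) * r := by rw [← hr]; ring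
    rw [h1]
    generalize (C (-1 / 2) : ℂ[X]) = c at hC
    have h2 : (1 + 2 * X : ℂ[X]) = 2 * (X - c) := by linear_combination hC
    rw [h2, show (-X - 1 - c : ℂ[X]) = -(X - c) by linear_combination -hC]
    ring
  have hne : ((1 + 2 * X : ℂ[X]) ^ 2) ≠ 0 := by
    apply pow_ne_zero
    intro h
    have := congrArg (eval 0) h
    simp at this
  rw [mul_comm]
  exact EuclideanDomain.mul_div_cancel' hne hdvd

theorem p_eq (q : ℂ[X]) : p q = (p0 q).comp (X ^ 2) + (p1 q).comp (X ^ 2) * X := by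
  rw [← expand_eq_comp_X_pow, ← expand_eq_comp_X_pow]
  ext n
  rw [coeff_add]
  rcases Nat.even_or_odd' n with ⟨k, rfl | rfl⟩
  · rcases k with _ | k
    · simp [p0, coeff_expand, coeff_contract]
    · rw [show 2 * (k + 1) = (2 * k + 1) + 1 by ring, coeff_mul_X, coeff_expand two_pos,
        coeff_expand two_pos, if_pos (by omega), if_neg (by omega), p0, coeff_contract two_ne_zero,
        add_zero]
      congr 1
      omega
  · rw [coeff_mul_X, coeff_expand two_pos, coeff_expand two_pos, if_neg (by omega),
      if_pos (by omega), p1, coeff_contract two_ne_zero, coeff_divX, zero_add]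
    congr 1
    omega

/-- The three generators of `D(q)`. -/
inductive Gen : Type
  | u
  | v
  | w

/-- The generator `u` in the free algebra. -/
noncomputable abbrev u : FreeAlgebra ℂ Gen := FreeAlgebra.ι ℂ Gen.u

/-- The generator `v` in the free algebra. -/
noncomputable abbrev v : FreeAlgebra ℂ Gen := FreeAlgebra.ι ℂ Gen.v

/-- The generator `w` in the free algebra. -/
noncomputable abbrev w : FreeAlgebra ℂ Gen := FreeAlgebra.ι ℂ Gen.w

/-- The defining relations of `D(q)`; `[x, y] = x y - y x` is written out. -/
inductive Rel (q : ℂ[X]) : FreeAlgebra ℂ Gen → FreeAlgebra ℂ Gen → Prop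
  | uv : Rel q (u * v - v * u) (2 * w + v)
  | uw : Rel q (u * w - w * u) (2 * (v * u) + w + algebraMap ℂ _ (rho q))
  | vw : Rel q (v * w - w * v) (-v ^ 2 - aeval u (p1 q))
  | ww : Rel q (w ^ 2) (v ^ 2 * u + v * w + rho q • v + aeval u (p0 q))

end KleinianD

/-- The noncommutative Kleinian singularity `D(q)` of type `D`: the unital associative
`ℂ`-algebra with generators `u, v, w` and the relations `KleinianD.Rel q`. -/
abbrev KleinianDAlgebra (q : ℂ[X]) : Type := RingQuot (KleinianD.Rel q)

/-! ### Ore condition from polynomial growth -/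

/-! Both algebras embed in one skew field, and their images generate the same division subring. The
ambient skew field is `ShiftField`, the fractions of the ring ℂ(x)[σ, σ⁻¹] of difference operators,
where σ f(x) = f(x+1) σ.

D(q) is mapped by u ↦ x², v ↦ A σ + B σ⁻¹ + G. Comparing coefficients, [u,v] = 2w + v determines w,
the constant term of the relation for [u,w] forces G = 2ρ/(1-4x²), and the last two relations rest
on A(x) B(x+1) = q(x) q(-x-1) / (x(x+1)(2x+1)²). The map is injective (`KleinianD.rep_injective`):
the monomials uⁱ vʲ wᵋ with ε ≤ 1 span D(q), and leading coefficients in σ show that their images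
are independent. So D(q) is a domain. It is Ore by growth: for suitable weights commutators of
generators drop the weight, so ordered monomials span and dimensions grow at most cubically, whereas
a failure of the Ore condition would make them grow exponentially (`left_ore_of_polynomial_growth`).
The Weyl algebra is treated in the same way.

For the comparison put Z = σ + σ⁻¹ and Y = x⁻¹(σ - σ⁻¹). Then YZ - ZY = Y², so Y⁻¹ and -Z form a
Weyl pair (`weylPair`), and x² Y² = Z² - 4 - ZY recovers u from Y and Z. Writing q(x)(2x-1) = h₀(x²)
+ h₁(x²) x, the elements (4u-1)v and (4u-1)(w+v) are, up to additive scalars, combinations of Z and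
Y over ℂ[u] with determinant h₀² - u h₁² ≠ 0. Hence u, v, w and Y, Z generate the same division
subring. -/

theorem exists_mul_pow_lt_two_pow (C d a c : ℕ) : ∃ k : ℕ, C * (a + k * c + 1) ^ d < 2 ^ k := by
  have h := tendsto_pow_const_div_const_pow_of_one_lt d (one_lt_two : (1 : ℝ) < 2)
  -- For n ≥ 1 one has a + n c + 1 ≤ n (a + c + 1), so it suffices that n^d M < 2^n for this
  -- constant M; its final `+ 1` makes M positive.
  have hpos : (0 : ℝ) < 1 / ((C * (a + c + 1) ^ d * 2 + 1 : ℕ) : ℝ) := by positivity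
  obtain ⟨n, hn, hn1⟩ := ((h.eventually_lt_const hpos).and
    (Filter.eventually_ge_atTop 1)).exists
  rw [div_lt_div_iff₀ (by positivity) (by positivity), one_mul] at hn
  refine ⟨n, ?_⟩
  have hn' : n ^ d * (C * (a + c + 1) ^ d * 2 + 1) < 2 ^ n := by exact_mod_cast hn
  have h1 : (a + n * c + 1) ^ d ≤ (n * (a + c + 1)) ^ d :=
    Nat.pow_le_pow_left (by nlinarith [Nat.mul_le_mul_right a hn1]) d
  calc C * (a + n * c + 1) ^ d ≤ C * (n * (a + c + 1)) ^ d := Nat.mul_le_mul_left _ h1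
    _ = n ^ d * (C * (a + c + 1) ^ d) := by rw [mul_pow]; ring
    _ ≤ n ^ d * (C * (a + c + 1) ^ d * 2 + 1) := Nat.mul_le_mul_left _ (by omega)
    _ < 2 ^ n := hn'

/-- A domain with an exhaustive filtration of polynomial growth, compatible with right
multiplications, satisfies the left Ore condition. -/
theorem left_ore_of_polynomial_growth {k R : Type*} [Field k] [Ring R] [IsDomain R] [Module k R]
    [IsScalarTower k R R] (V : ℕ → Submodule k R) (hfin : ∀ n, Module.Finite k (V n))
    (hone : 1 ∈ V 0) (hmono : Monotone V)
    (hmul : ∀ r : R, ∃ c, ∀ n, ∀ x ∈ V n, x * r ∈ V (n + c))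
    (C d : ℕ) (hgrowth : ∀ n, Module.finrank k (V n) ≤ C * (n + 1) ^ d) (r s : R) (hs : s ≠ 0) :
    ∃ r' s' : R, s' ≠ 0 ∧ s' * r = r' * s := by
  by_contra! hcon
  obtain ⟨c₁, h₁⟩ := hmul r
  obtain ⟨c₂, h₂⟩ := hmul s
  -- If the only relation x r + y s = 0 is the trivial one, then (x, y) ↦ x r + y s embeds two
  -- copies of `V n` in a later step of the filtration.
  have hstep : ∀ n, 2 * Module.finrank k (V n) ≤ Module.finrank k (V (n + (c₁ + c₂))) := by
    intro n
    let f : (V n × V n) →ₗ[k] V (n + (c₁ + c₂)) :=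
      { toFun := fun x => ⟨x.1 * r + x.2 * s, add_mem
          (hmono (by omega) (h₁ n _ x.1.2)) (hmono (by omega) (h₂ n _ x.2.2))⟩
        map_add' := fun x y => Subtype.ext (by
          simp only [Prod.fst_add, Prod.snd_add, Submodule.coe_add, add_mul]; abel)
        map_smul' := fun a x => Subtype.ext (by
          simp only [Prod.smul_fst, Prod.smul_snd, Submodule.coe_smul, smul_mul_assoc,
            RingHom.id_apply, smul_add]) }
    have hf : Function.Injective f := by
      rw [← LinearMap.ker_eq_bot, LinearMap.ker_eq_bot']
      rintro ⟨⟨x, hx⟩, ⟨y, hy⟩⟩ h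
      have h' : x * r + y * s = 0 := congrArg Subtype.val h
      have hx0 : x = 0 := by
        by_contra hx0
        exact hcon (-y) x hx0 (by rw [neg_mul]; exact eq_neg_of_add_eq_zero_left h')
      subst hx0
      have hy0 : y = 0 := by simpa [hs] using h'
      subst hy0
      rfl
    have := hfin n
    have := hfin (n + (c₁ + c₂))
    have := LinearMap.finrank_le_finrank_of_injective hf
    rw [Module.finrank_prod] at this
    omega
  have hpow : ∀ m, 2 ^ m ≤ Module.finrank k (V (0 + m * (c₁ + c₂))) := by
    intro m
    induction m with
    | zero =>
      have := hfin 0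
      have : Nontrivial (V (0 + 0 * (c₁ + c₂))) := by
        rw [zero_mul]
        exact ⟨⟨⟨1, hone⟩, 0, fun h => one_ne_zero (congrArg Subtype.val h)⟩⟩
      have := hfin (0 + 0 * (c₁ + c₂))
      exact Module.finrank_pos
    | succ m ih =>
      have := hstep (0 + m * (c₁ + c₂))
      rw [show 0 + (m + 1) * (c₁ + c₂) = 0 + m * (c₁ + c₂) + (c₁ + c₂) by ring, pow_succ]
      omega
  obtain ⟨m, hm⟩ := exists_mul_pow_lt_two_pow C d 0 (c₁ + c₂)
  exact absurd ((hpow m).trans (hgrowth _)) (not_le.mpr hm)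

theorem isOreDomain_of_polynomial_growth {k R : Type*} [Field k] [Ring R] [IsDomain R]
    [Algebra k R] (V : ℕ → Submodule k R) (hfin : ∀ n, Module.Finite k (V n))
    (hone : 1 ∈ V 0) (hmono : Monotone V)
    (hmul : ∀ m n, ∀ x ∈ V m, ∀ y ∈ V n, x * y ∈ V (m + n)) (htop : ∀ x, ∃ n, x ∈ V n)
    (C d : ℕ) (hgrowth : ∀ n, Module.finrank k (V n) ≤ C * (n + 1) ^ d) : IsOreDomain R where
  left_ore := left_ore_of_polynomial_growth V hfin hone hmono
    (fun r => (htop r).imp fun c hc n x hx => hmul n c x hx r hc) C d hgrowth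
  right_ore r s hs := by
    -- The right condition is the left condition in the opposite ring, with the same filtration.
    let e : R ≃ₗ[k] Rᵐᵒᵖ := MulOpposite.opLinearEquiv k
    obtain ⟨r', s', hs', h⟩ := left_ore_of_polynomial_growth (k := k) (R := Rᵐᵒᵖ)
      (fun n => (V n).map (e : R →ₗ[k] Rᵐᵒᵖ))
      (fun n => by have := hfin n; infer_instance) ⟨1, hone, rfl⟩
      (fun m n h => Submodule.map_mono (hmono h))
      (fun r => (htop r.unop).imp fun c hc n x hx => by
        obtain ⟨y, hy, rfl⟩ := hx
        exact ⟨r.unop * y, by rw [add_comm]; exact hmul c n _ hc y hy, rfl⟩)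
      C d (fun n => by rw [LinearEquiv.finrank_map_eq]; exact hgrowth n)
      (MulOpposite.op r) (MulOpposite.op s) (by simpa using hs)
    exact ⟨r'.unop, s'.unop, by simpa using hs', congrArg MulOpposite.unop h⟩

/-! ### Filtrations by weight -/

section WeightFiltration

variable {k A ι : Type*} [Field k] [Ring A] [Algebra k A]

/-- The span of all words of weight at most `n` in the elements `g i` of weight `wt i`. -/
def weightFiltration (k : Type*) {A ι : Type*} [Field k] [Ring A] [Algebra k A] (g : ι → A)
    (wt : ι → ℕ) (n : ℕ) : Submodule k A :=
  Submodule.span k {x | ∃ l : List ι, (l.map wt).sum ≤ n ∧ (l.map g).prod = x}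

namespace weightFiltration

variable (g : ι → A) (wt : ι → ℕ)

theorem word_mem {l : List ι} {n : ℕ} (h : (l.map wt).sum ≤ n) :
    (l.map g).prod ∈ weightFiltration k g wt n :=
  Submodule.subset_span ⟨l, h, rfl⟩

theorem mono : Monotone (weightFiltration k g wt) := fun _ _ h =>
  Submodule.span_mono fun _ ⟨l, hl, hx⟩ => ⟨l, hl.trans h, hx⟩

theorem one_mem (n : ℕ) : 1 ∈ weightFiltration k g wt n :=
  word_mem g wt (l := []) (by simp)

theorem gen_mem (i : ι) : g i ∈ weightFiltration k g wt (wt i) := by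
  simpa using word_mem (k := k) g wt (l := [i]) (n := wt i) (by simp)

theorem mul_mem {m n : ℕ} {x y : A} (hx : x ∈ weightFiltration k g wt m)
    (hy : y ∈ weightFiltration k g wt n) : x * y ∈ weightFiltration k g wt (m + n) := by
  have h := Submodule.mul_mem_mul hx hy
  rw [weightFiltration, weightFiltration, Submodule.span_mul_span] at h
  refine Submodule.span_mono ?_ h
  rintro _ ⟨_, ⟨l, hl, rfl⟩, _, ⟨l', hl', rfl⟩, rfl⟩
  exact ⟨l ++ l', by simpa using Nat.add_le_add hl hl', by simp⟩

theorem mul_mem_of_le {m n r : ℕ} {x y : A} (hx : x ∈ weightFiltration k g wt m)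
    (hy : y ∈ weightFiltration k g wt n) (h : m + n ≤ r) :
    x * y ∈ weightFiltration k g wt r :=
  mono g wt h (mul_mem g wt hx hy)

theorem pow_mem {m : ℕ} {x : A} (hx : x ∈ weightFiltration k g wt m) (i : ℕ) :
    x ^ i ∈ weightFiltration k g wt (i * m) := by
  induction i with
  | zero => simpa using one_mem g wt _
  | succ i ih => rw [pow_succ]; exact mul_mem_of_le g wt ih hx (by rw [Nat.succ_mul])

theorem exists_mem (htop : Algebra.adjoin k (Set.range g) = ⊤) (x : A) :
    ∃ n, x ∈ weightFiltration k g wt n := by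
  have hx : x ∈ Algebra.adjoin k (Set.range g) := htop ▸ Algebra.mem_top
  induction hx using Algebra.adjoin_induction with
  | mem x hx => obtain ⟨i, rfl⟩ := hx; exact ⟨_, gen_mem g wt i⟩
  | algebraMap r =>
    exact ⟨0, by rw [Algebra.algebraMap_eq_smul_one]; exact Submodule.smul_mem _ _ (one_mem g wt 0)⟩
  | add x y _ _ hx hy =>
    obtain ⟨m, hm⟩ := hx
    obtain ⟨n, hn⟩ := hy
    exact ⟨m + n, add_mem (mono g wt (by omega) hm) (mono g wt (by omega) hn)⟩
  | mul x y _ _ hx hy =>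
    obtain ⟨m, hm⟩ := hx
    obtain ⟨n, hn⟩ := hy
    exact ⟨m + n, mul_mem g wt hm hn⟩

variable {g wt}

/-- If commutators of generators drop the weight, then so do all commutators. -/
theorem commutator_mem (hwt : ∀ i, 0 < wt i)
    (hcomm : ∀ i j n, wt i + wt j = n + 1 → g i * g j - g j * g i ∈ weightFiltration k g wt n)
    {m n r : ℕ} {x y : A} (hx : x ∈ weightFiltration k g wt m)
    (hy : y ∈ weightFiltration k g wt n) (h : m + n ≤ r + 1) :
    x * y - y * x ∈ weightFiltration k g wt r := by
  -- Leibniz rule, first for a letter against a word, then (`h2`) for two words. The drop by one is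
  -- written with `r + 1` on the right to avoid truncated subtraction.
  have h1 : ∀ (i : ι) (l : List ι) (r : ℕ), wt i + (l.map wt).sum ≤ r + 1 →
      g i * (l.map g).prod - (l.map g).prod * g i ∈ weightFiltration k g wt r := by
    intro i l
    induction l with
    | nil => intro r _; simp
    | cons j l ih =>
      intro r hr
      simp only [List.map_cons, List.prod_cons, List.sum_cons] at hr ⊢
      obtain ⟨a, ha⟩ := Nat.exists_eq_succ_of_ne_zero (hwt i).ne'
      have e : g i * (g j * (l.map g).prod) - g j * (l.map g).prod * g i
          = (g i * g j - g j * g i) * (l.map g).prod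
            + g j * (g i * (l.map g).prod - (l.map g).prod * g i) := by noncomm_ring
      rw [e]
      refine add_mem (mul_mem_of_le g wt (hcomm i j (a + wt j) (by omega)) (word_mem g wt le_rfl)
        (by omega)) (mul_mem_of_le g wt (gen_mem g wt j)
          (ih (a + (l.map wt).sum) (by omega)) (by omega))
  have h2 : ∀ (l l' : List ι) (r : ℕ), (l.map wt).sum + (l'.map wt).sum ≤ r + 1 →
      (l.map g).prod * (l'.map g).prod - (l'.map g).prod * (l.map g).prod
        ∈ weightFiltration k g wt r := by
    intro l l'
    induction l with
    | nil => intro r _; simp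
    | cons i l ih =>
      intro r hr
      simp only [List.map_cons, List.prod_cons, List.sum_cons] at hr ⊢
      rcases l' with _ | ⟨j, l'⟩
      · simp
      set y := ((j :: l').map g).prod
      set n := ((j :: l').map wt).sum with hn
      have hn0 : 0 < n := by simp [hn, hwt j]
      obtain ⟨b, hb⟩ := Nat.exists_eq_succ_of_ne_zero hn0.ne'
      have e : g i * (l.map g).prod * y - y * (g i * (l.map g).prod)
          = g i * ((l.map g).prod * y - y * (l.map g).prod)
            + (g i * y - y * g i) * (l.map g).prod := by noncomm_ring
      rw [e]
      refine add_mem (mul_mem_of_le g wt (gen_mem g wt i) (ih ((l.map wt).sum + b) (by omega))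
          (by omega))
        (mul_mem_of_le g wt (h1 i (j :: l') (wt i + b) (by omega)) (word_mem g wt le_rfl)
          (by omega))
  induction hx using Submodule.span_induction with
  | zero => simp
  | add x x' _ _ hx hx' =>
    rw [show (x + x') * y - y * (x + x') = (x * y - y * x) + (x' * y - y * x') by noncomm_ring]
    exact add_mem hx hx'
  | smul a x _ hx =>
    rw [smul_mul_assoc, mul_smul_comm, ← smul_sub]
    exact Submodule.smul_mem _ _ hx
  | mem x hx =>
    obtain ⟨l, hl, rfl⟩ := hx
    induction hy using Submodule.span_induction with
    | zero => simp
    | add y y' _ _ hy hy' =>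
      rw [mul_add, add_mul, add_sub_add_comm]
      exact add_mem hy hy'
    | smul a y _ hy =>
      rw [smul_mul_assoc, mul_smul_comm, ← smul_sub]
      exact Submodule.smul_mem _ _ hy
    | mem y hy =>
      obtain ⟨l', hl', rfl⟩ := hy
      exact h2 l l' r (by omega)

/-- The ordered monomials of weight at most `n` span the filtration. -/
theorem le_span_monomials {g : Fin 3 → A} {wt : Fin 3 → ℕ} (hwt : ∀ i, 0 < wt i)
    (hcomm : ∀ i j n, wt i + wt j = n + 1 → g i * g j - g j * g i ∈ weightFiltration k g wt n)
    (n : ℕ) : weightFiltration k g wt n ≤ Submodule.span k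
      {x | ∃ a b c : ℕ, a * wt 0 + b * wt 1 + c * wt 2 ≤ n ∧ g 0 ^ a * g 1 ^ b * g 2 ^ c = x} := by
  induction n using Nat.strong_induction_on with
  | _ n ih =>
  have hlow : ∀ m, m < n → ∀ x ∈ weightFiltration k g wt m, x ∈ Submodule.span k
      {x | ∃ a b c : ℕ, a * wt 0 + b * wt 1 + c * wt 2 ≤ n ∧
        g 0 ^ a * g 1 ^ b * g 2 ^ c = x} := fun m hm x hx =>
    Submodule.span_mono (by rintro _ ⟨a, b, c, h, e⟩; exact ⟨a, b, c, h.trans hm.le, e⟩)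
      (ih m hm hx)
  refine Submodule.span_le.mpr ?_
  rintro _ ⟨l, hl, rfl⟩
  rcases l with _ | ⟨i, l⟩
  · exact Submodule.subset_span ⟨0, 0, 0, by simp⟩
  simp only [List.map_cons, List.prod_cons, List.sum_cons] at hl ⊢
  have hw := hwt i
  -- After the first letter is removed the word has weight below n, so it is a combination of
  -- ordered monomials. Moving the letter back to its place costs a commutator of weight below n,
  -- covered again by induction.
  have key := ih _ (show (l.map wt).sum < n by omega) (word_mem g wt le_rfl)
  generalize (l.map g).prod = y at key
  induction key using Submodule.span_induction with
  | zero => simp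
  | add x y _ _ hx hy => rw [SetLike.mem_coe, mul_add]; exact add_mem hx hy
  | smul a x _ hx => rw [SetLike.mem_coe, mul_smul_comm]; exact Submodule.smul_mem _ _ hx
  | mem y hy =>
    obtain ⟨a, b, c, h, rfl⟩ := hy
    have ha := pow_mem (k := k) g wt (gen_mem g wt 0) a
    have hb := pow_mem (k := k) g wt (gen_mem g wt 1) b
    have hc := pow_mem (k := k) g wt (gen_mem g wt 2) c
    have hw0 := hwt 0
    have hw1 := hwt 1
    have hw2 := hwt 2
    have hi : i = 0 ∨ i = 1 ∨ i = 2 := by omega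
    rcases hi with rfl | rfl | rfl
    · exact Submodule.subset_span ⟨a + 1, b, c, by rw [Nat.succ_mul]; omega, by
        rw [pow_succ']; noncomm_ring⟩
    · have e : g 1 * (g 0 ^ a * g 1 ^ b * g 2 ^ c) = g 0 ^ a * g 1 ^ (b + 1) * g 2 ^ c
          + (g 1 * g 0 ^ a - g 0 ^ a * g 1) * (g 1 ^ b * g 2 ^ c) := by
        rw [pow_succ']; noncomm_ring
      rw [SetLike.mem_coe, e]
      refine add_mem (Submodule.subset_span ⟨a, b + 1, c, by rw [Nat.succ_mul]; omega, rfl⟩)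
        (hlow (n - 1) (by omega) _ ?_)
      exact mul_mem_of_le g wt (commutator_mem hwt hcomm (r := wt 1 + a * wt 0 - 1)
        (gen_mem g wt 1) ha (by omega)) (mul_mem g wt hb hc) (by omega)
    · have e : g 2 * (g 0 ^ a * g 1 ^ b * g 2 ^ c) = g 0 ^ a * g 1 ^ b * g 2 ^ (c + 1)
          + (g 2 * (g 0 ^ a * g 1 ^ b) - g 0 ^ a * g 1 ^ b * g 2) * g 2 ^ c := by
        rw [pow_succ']; noncomm_ring
      rw [SetLike.mem_coe, e]
      refine add_mem (Submodule.subset_span ⟨a, b, c + 1, by rw [Nat.succ_mul]; omega, rfl⟩)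
        (hlow (n - 1) (by omega) _ ?_)
      exact mul_mem_of_le g wt (commutator_mem hwt hcomm
        (r := wt 2 + (a * wt 0 + b * wt 1) - 1)
        (gen_mem g wt 2) (mul_mem g wt ha hb) (by omega)) hc (by omega)

/-- Positive weights bound each exponent of an ordered monomial of weight at most n by n, which
leaves at most (n+1)³ monomials. -/
theorem finite_and_finrank_le {g : Fin 3 → A} {wt : Fin 3 → ℕ} (hwt : ∀ i, 0 < wt i)
    (hcomm : ∀ i j n, wt i + wt j = n + 1 → g i * g j - g j * g i ∈ weightFiltration k g wt n)
    (n : ℕ) : Module.Finite k (weightFiltration k g wt n) ∧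
      Module.finrank k (weightFiltration k g wt n) ≤ 1 * (n + 1) ^ 3 := by
  classical
  let T : Finset A := (Finset.range (n + 1) ×ˢ Finset.range (n + 1) ×ˢ Finset.range (n + 1)).image
    fun t => g 0 ^ t.1 * g 1 ^ t.2.1 * g 2 ^ t.2.2
  have hT : weightFiltration k g wt n ≤ Submodule.span k (T : Set A) := by
    refine (le_span_monomials hwt hcomm n).trans (Submodule.span_mono ?_)
    rintro _ ⟨a, b, c, h, rfl⟩
    have ha := Nat.le_mul_of_pos_right a (hwt 0)
    have hb := Nat.le_mul_of_pos_right b (hwt 1)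
    have hc := Nat.le_mul_of_pos_right c (hwt 2)
    exact Finset.mem_image.mpr ⟨(a, b, c), by
      simp only [Finset.mem_product, Finset.mem_range]; omega, rfl⟩
  have hfinT : Module.Finite k (Submodule.span k (T : Set A)) :=
    FiniteDimensional.span_finset k T
  refine ⟨Submodule.finiteDimensional_of_le hT, (Submodule.finrank_mono hT).trans
    ((finrank_span_finset_le_card T).trans (Finset.card_image_le.trans ?_))⟩
  simp only [Finset.card_product, Finset.card_range]
  exact le_of_eq (by ring)

/-- A domain generated by three weighted elements whose commutators drop the weight is Ore. -/
theorem isOreDomain [IsDomain A] {g : Fin 3 → A} {wt : Fin 3 → ℕ} (hwt : ∀ i, 0 < wt i)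
    (hcomm : ∀ i j n, wt i + wt j = n + 1 → g i * g j - g j * g i ∈ weightFiltration k g wt n)
    (htop : Algebra.adjoin k (Set.range g) = ⊤) : IsOreDomain A :=
  isOreDomain_of_polynomial_growth (k := k) (weightFiltration k g wt)
    (fun n => (finite_and_finrank_le hwt hcomm n).1) (one_mem g wt 0) (mono g wt)
    (fun _ _ _ hx _ hy => mul_mem g wt hx hy) (exists_mem g wt htop) 1 3
    fun n => (finite_and_finrank_le hwt hcomm n).2

end weightFiltration

end WeightFiltration

/-! ### The algebra of difference operators with rational coefficients -/

namespace SkewMonoidAlgebra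

variable {k G : Type*}

theorem coeff_mul_of_uniqueMul [Semiring k] [Monoid G] [MulSemiringAction G k]
    {f g : SkewMonoidAlgebra k G} {a b : G} (h : UniqueMul f.support g.support a b) :
    (f * g).coeff (a * b) = f.coeff a * a • g.coeff b := by
  classical
  rw [coeff_mul, sum_def, Finsupp.sum, support_coeff]
  simp_rw [sum_def, Finsupp.sum, support_coeff]
  rw [← Finset.sum_product']
  refine (Finset.sum_eq_single (a, b) ?_ ?_).trans (if_pos rfl)
  · rintro ⟨c, d⟩ hcd hne
    rw [Finset.mem_product] at hcd
    refine if_neg fun h' => hne ?_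
    obtain ⟨rfl, rfl⟩ := h hcd.1 hcd.2 h'
    rfl
  · intro hab
    rw [Finset.mem_product, not_and_or, notMem_support_iff, notMem_support_iff] at hab
    rcases hab with h0 | h0 <;> simp [h0]

/-- A pair (a, b) in the supports whose product is attained only once contributes alone to its
coefficient, which is f_a · (a • g_b); it is nonzero because a group element acts injectively. -/
instance instNoZeroDivisors [Semiring k] [NoZeroDivisors k] [Group G] [UniqueProds G]
    [MulSemiringAction G k] : NoZeroDivisors (SkewMonoidAlgebra k G) where
  eq_zero_or_eq_zero_of_mul_eq_zero {f g} hfg := by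
    contrapose! hfg
    have hf : f.support.Nonempty := Finset.nonempty_iff_ne_empty.mpr (by simpa using hfg.1)
    have hg : g.support.Nonempty := Finset.nonempty_iff_ne_empty.mpr (by simpa using hfg.2)
    obtain ⟨a, ha, b, hb, h⟩ := UniqueProds.uniqueMul_of_nonempty hf hg
    intro h0
    have := coeff_mul_of_uniqueMul h
    rw [h0, coeff_zero, Finsupp.zero_apply, eq_comm, mul_eq_zero] at this
    rw [mem_support_iff] at ha hb
    refine this.elim ha fun h' => hb ?_
    have h2 := congrArg (a⁻¹ • ·) h'
    simpa using h2

end SkewMonoidAlgebra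

/-- The field of rational functions `ℂ(x)`, with a single path to each of its structures. -/
def RatFun : Type := FractionRing ℂ[X]

namespace RatFun

noncomputable instance : Field RatFun := inferInstanceAs (Field (FractionRing ℂ[X]))
noncomputable instance : Algebra ℂ[X] RatFun := inferInstanceAs (Algebra ℂ[X] (FractionRing ℂ[X]))
noncomputable instance : Algebra ℂ RatFun := inferInstanceAs (Algebra ℂ (FractionRing ℂ[X]))
instance : IsScalarTower ℂ ℂ[X] RatFun :=
  inferInstanceAs (IsScalarTower ℂ ℂ[X] (FractionRing ℂ[X]))
instance : IsFractionRing ℂ[X] RatFun := inferInstanceAs (IsFractionRing ℂ[X] (FractionRing ℂ[X]))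
instance : CharZero RatFun :=
  charZero_of_injective_algebraMap (algebraMap ℂ RatFun).injective

/-- The variable of `ℂ(x)`. -/
noncomputable def X : RatFun := algebraMap ℂ[X] RatFun Polynomial.X

end RatFun

/-- Translation of polynomials, as an action of the integers. -/
noncomputable def polyShift : Multiplicative ℤ →* (ℂ[X] ≃ₐ[ℂ] ℂ[X]) where
  toFun m := algEquivAevalXAddC ((m.toAdd : ℤ) : ℂ)
  map_one' := by
    refine AlgEquiv.coe_toAlgHom_injective (Polynomial.algHom_ext ?_)
    simp
  map_mul' m n := by
    refine AlgEquiv.coe_toAlgHom_injective (Polynomial.algHom_ext ?_)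
    simp [add_assoc]

noncomputable instance instActionRatFun : MulSemiringAction (Multiplicative ℤ) RatFun :=
  MulSemiringAction.compHom RatFun
    ((IsFractionRing.fieldEquivOfAlgEquivHom (A := ℂ) (B := ℂ[X]) ℂ RatFun).comp polyShift)

theorem ofAdd_smul_algebraMap (m : ℤ) (p : ℂ[X]) :
    Multiplicative.ofAdd m • algebraMap ℂ[X] RatFun p
      = algebraMap ℂ[X] RatFun (p.comp (X + C (m : ℂ))) := by
  change (IsFractionRing.fieldEquivOfAlgEquivHom (A := ℂ) (B := ℂ[X]) ℂ RatFun)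
    (polyShift (Multiplicative.ofAdd m)) (algebraMap ℂ[X] RatFun p) = _
  rw [IsFractionRing.fieldEquivOfAlgEquivHom_apply, IsFractionRing.fieldEquivOfAlgEquiv_algebraMap]
  simp [polyShift, comp_eq_aeval]

instance : SMulCommClass (Multiplicative ℤ) ℂ RatFun where
  smul_comm m c f := by
    rw [Algebra.smul_def, Algebra.smul_def, smul_mul', IsScalarTower.algebraMap_apply ℂ ℂ[X],
      ← ofAdd_toAdd m, ofAdd_smul_algebraMap]
    simp

/-- Translation of rational functions by an integer. -/
noncomputable def ratShift (m : ℤ) : RatFun →ₐ[ℂ] RatFun :=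
  MulSemiringAction.toAlgHom ℂ RatFun (Multiplicative.ofAdd m)

theorem ratShift_X (m : ℤ) : ratShift m RatFun.X = RatFun.X + (m : RatFun) := by
  refine (ofAdd_smul_algebraMap m Polynomial.X).trans ?_
  simp [RatFun.X]

theorem ratShift_zero (f : RatFun) : ratShift 0 f = f :=
  one_smul (Multiplicative ℤ) f

/-- The algebra of difference operators on the line with rational coefficients. -/
abbrev ShiftAlgebra : Type := SkewMonoidAlgebra RatFun (Multiplicative ℤ)

namespace ShiftAlgebra

/-- The difference operator `f σⁿ`. -/
noncomputable def term (n : ℤ) (f : RatFun) : ShiftAlgebra :=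
  SkewMonoidAlgebra.single (Multiplicative.ofAdd n) f

theorem term_mul (m n : ℤ) (f g : RatFun) :
    term m f * term n g = term (m + n) (f * ratShift m g) :=
  SkewMonoidAlgebra.single_mul_single

theorem term_zero_mul (n : ℤ) (f g : RatFun) :
    term 0 f * term n g = term n (f * g) := by
  rw [term_mul, ratShift_zero, zero_add]

theorem term_add (n : ℤ) (f g : RatFun) : term n (f + g) = term n f + term n g :=
  SkewMonoidAlgebra.single_add _ _ _

theorem term_sub (n : ℤ) (f g : RatFun) : term n (f - g) = term n f - term n g := by
  rw [eq_sub_iff_add_eq, ← term_add, sub_add_cancel]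

theorem term_neg (n : ℤ) (f : RatFun) : term n (-f) = -term n f :=
  SkewMonoidAlgebra.single_neg _ _

theorem term_zero_right (n : ℤ) : term n 0 = 0 :=
  SkewMonoidAlgebra.single_zero _

theorem one_eq_term : (1 : ShiftAlgebra) = term 0 1 := rfl

theorem coeff_term (n m : ℤ) (f : RatFun) :
    (term n f).coeff (Multiplicative.ofAdd m) = if n = m then f else 0 := by
  classical
  rw [term, SkewMonoidAlgebra.coeff_single_apply]
  simp

theorem algebraMap_eq_term (r : ℂ) :
    algebraMap ℂ ShiftAlgebra r = term 0 (algebraMap ℂ RatFun r) := by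
  rw [SkewMonoidAlgebra.coe_algebraMap]
  rfl

/-- The inclusion of the rational functions. -/
noncomputable def const : RatFun →ₐ[ℂ] ShiftAlgebra where
  toFun := term 0
  map_one' := rfl
  map_zero' := term_zero_right 0
  map_mul' f g := (term_zero_mul 0 f g).symm
  map_add' := term_add 0
  commutes' r := (algebraMap_eq_term r).symm

theorem const_apply (f : RatFun) : const f = term 0 f := rfl

noncomputable instance : IsDomain ShiftAlgebra := NoZeroDivisors.to_isDomain _

open Classical in
/-- The difference operators with support in `[-n, n]`. -/
noncomputable def bounded (n : ℕ) : Submodule RatFun ShiftAlgebra :=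
  Submodule.span RatFun
    ((Finset.Icc (-n : ℤ) n).image (fun i => term i 1) : Finset ShiftAlgebra)

open Classical in
theorem term_mem_bounded {i : ℤ} {n : ℕ} (f : RatFun) (h : i ∈ Finset.Icc (-n : ℤ) n) :
    term i f ∈ bounded n := by
  have : term i f = f • term i 1 := by
    rw [term, term, SkewMonoidAlgebra.smul_single, smul_eq_mul, mul_one]
  rw [this]
  exact Submodule.smul_mem _ _
    (Submodule.subset_span (Finset.mem_coe.mpr (Finset.mem_image_of_mem _ h)))

open Classical in
theorem bounded_mono : Monotone bounded := fun m n h => by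
  refine Submodule.span_le.mpr fun x hx => ?_
  obtain ⟨i, hi, rfl⟩ := Finset.mem_image.mp hx
  rw [Finset.mem_Icc] at hi
  exact term_mem_bounded _ (Finset.mem_Icc.mpr (by omega))

open Classical in
theorem exists_bounded_mul (r : ShiftAlgebra) :
    ∃ c, ∀ n, ∀ x ∈ bounded n, x * r ∈ bounded (n + c) := by
  induction r using SkewMonoidAlgebra.induction_on with
  | zero => exact ⟨0, fun n x _ => by simp⟩
  | add f g hf hg =>
    obtain ⟨a, ha⟩ := hf
    obtain ⟨b, hb⟩ := hg
    refine ⟨a + b, fun n x hx => ?_⟩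
    rw [mul_add]
    exact add_mem (bounded_mono (by omega) (ha n x hx)) (bounded_mono (by omega) (hb n x hx))
  | single g a =>
    refine ⟨g.toAdd.natAbs, fun n x hx => ?_⟩
    induction hx using Submodule.span_induction with
    | zero => simp
    | add x y _ _ hx hy => rw [add_mul]; exact add_mem hx hy
    | smul c x _ hx => rw [smul_mul_assoc]; exact Submodule.smul_mem _ _ hx
    | mem x hx =>
      obtain ⟨i, hi, rfl⟩ := Finset.mem_image.mp hx
      rw [Finset.mem_Icc] at hi
      change term i 1 * term g.toAdd a ∈ _
      rw [term_mul]
      exact term_mem_bounded _ (Finset.mem_Icc.mpr (by omega))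

open Classical in
-- Growth is measured over ℂ(x) instead of ℂ: `bounded n` has dimension at most 2n + 1. The
-- coefficients are not central, but left scalars commute with right multiplications, and the growth
-- criterion needs no more.
theorem left_ore (r s : ShiftAlgebra) (hs : s ≠ 0) :
    ∃ r' s' : ShiftAlgebra, s' ≠ 0 ∧ s' * r = r' * s := by
  refine left_ore_of_polynomial_growth bounded
    (fun n => FiniteDimensional.span_finset _ _) (term_mem_bounded 1 (by simp)) bounded_mono
    exists_bounded_mul 2 1 (fun n => ?_) r s hs
  refine (finrank_span_finset_le_card _).trans (Finset.card_image_le.trans ?_)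
  rw [Int.card_Icc, pow_one]
  omega

noncomputable instance : OreLocalization.OreSet ShiftAlgebra⁰ :=
  (OreLocalization.nonempty_oreSet_iff_of_noZeroDivisors.mpr fun r s => by
    obtain ⟨r', s', hs', h⟩ := left_ore r (s : ShiftAlgebra) (nonZeroDivisors.ne_zero s.2)
    exact ⟨r', ⟨s', mem_nonZeroDivisors_of_ne_zero hs'⟩, h⟩).some

end ShiftAlgebra

/-- The skew field of rational difference operators. -/
abbrev ShiftField : Type := OreLocalization ShiftAlgebra⁰ ShiftAlgebra

namespace ShiftField

/-- The inclusion of the difference operators into their skew field of fractions. -/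
noncomputable def of : ShiftAlgebra →ₐ[ℂ] ShiftField where
  __ := (OreLocalization.numeratorRingHom : ShiftAlgebra →+* ShiftField)
  commutes' _ := rfl

theorem of_injective : Function.Injective of :=
  OreLocalization.numeratorHom_inj (fun _ h => (mem_nonZeroDivisors_iff.mp h).1)

end ShiftField

/-! ### Arithmetic of difference operators with few terms -/

namespace ShiftAlgebra

/-- The difference operator `a σ² + b σ⁻² + c σ + d σ⁻¹ + e`. -/
noncomputable def penta (a b c d e : RatFun) : ShiftAlgebra :=
  term 2 a + term (-2) b + term 1 c + term (-1) d + term 0 e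

theorem penta_add (a b c d e a' b' c' d' e' : RatFun) :
    penta a b c d e + penta a' b' c' d' e'
      = penta (a + a') (b + b') (c + c') (d + d') (e + e') := by
  simp only [penta, term_add]; abel

theorem penta_neg (a b c d e : RatFun) :
    -penta a b c d e = penta (-a) (-b) (-c) (-d) (-e) := by
  simp only [penta, term_neg]; abel

theorem penta_sub (a b c d e a' b' c' d' e' : RatFun) :
    penta a b c d e - penta a' b' c' d' e'
      = penta (a - a') (b - b') (c - c') (d - d') (e - e') := by
  simp only [penta, term_sub]; abel

theorem const_eq_penta (f : RatFun) : const f = penta 0 0 0 0 f := by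
  simp [penta, const_apply, term_zero_right]

theorem const_mul_penta (f a b c d e : RatFun) :
    const f * penta a b c d e = penta (f * a) (f * b) (f * c) (f * d) (f * e) := by
  simp only [penta, const_apply, mul_add, term_zero_mul]

theorem penta_mul_penta (c d e c' d' e' : RatFun) :
    penta 0 0 c d e * penta 0 0 c' d' e' =
      penta (c * ratShift 1 c') (d * ratShift (-1) d')
        (c * ratShift 1 e' + e * c')
        (d * ratShift (-1) e' + e * d')
        (c * ratShift 1 d' + d * ratShift (-1) c'
          + e * e') := by
  simp only [penta, term_zero_right, zero_add, term_add, mul_add, add_mul, term_mul, add_zero,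
    ratShift_zero, Int.reduceAdd, Int.reduceNeg]
  abel

end ShiftAlgebra

theorem RatFun.linear_ne_zero {a : ℤ} (b : ℤ) (ha : a ≠ 0) :
    (a : RatFun) * RatFun.X + (b : RatFun) ≠ 0 := by
  rw [RatFun.X, ← map_intCast (algebraMap ℂ[X] RatFun), ← map_intCast (algebraMap ℂ[X] RatFun),
    ← map_mul, ← map_add]
  refine fun h => ha ?_
  rw [map_eq_zero_iff _ (IsFractionRing.injective ℂ[X] RatFun)] at h
  have := congrArg (fun p => p.coeff 1) h
  rw [← C_eq_intCast, ← C_eq_intCast] at this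
  simpa only [coeff_add, coeff_C_mul, coeff_X_one, mul_one, coeff_C_of_ne_zero one_ne_zero,
    add_zero,
    coeff_zero, Int.cast_eq_zero] using this

section FieldIdentities

variable {F : Type*} [Field F] [CharZero F] {x a b c d r e f : F}

/-- For a = p₀(x²) and b = p₁(x²) the hypotheses give p(x) and p(-x), whose half sum is a. This and
`odd_part_eq` express p₀ and p₁ through q when the relations are checked. -/
theorem even_part_eq (h1 : 2 * x + 1 ≠ 0) (h2 : 2 * x - 1 ≠ 0)
    (h : (a + b * x) * (2 * x + 1) ^ 2 = c) (h' : (a - b * x) * (2 * x - 1) ^ 2 = d) :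
    a = (c / (2 * x + 1) ^ 2 + d / (2 * x - 1) ^ 2) / 2 := by
  rw [← h, ← h', mul_div_cancel_right₀ _ (pow_ne_zero 2 h1),
    mul_div_cancel_right₀ _ (pow_ne_zero 2 h2)]
  ring

theorem odd_part_eq (hx : x ≠ 0) (h1 : 2 * x + 1 ≠ 0) (h2 : 2 * x - 1 ≠ 0)
    (h : (a + b * x) * (2 * x + 1) ^ 2 = c) (h' : (a - b * x) * (2 * x - 1) ^ 2 = d) :
    b = (c / (2 * x + 1) ^ 2 - d / (2 * x - 1) ^ 2) / (2 * x) := by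
  rw [← h, ← h', mul_div_cancel_right₀ _ (pow_ne_zero 2 h1),
    mul_div_cancel_right₀ _ (pow_ne_zero 2 h2)]
  field_simp
  ring

end FieldIdentities

/-! ### The relations of D(q) for difference operators -/

namespace KleinianD

open ShiftAlgebra

/-- The coefficient of `σ` in the image of `v`. -/
noncomputable def coeffA (q : ℂ[X]) : RatFun := aeval RatFun.X q / (RatFun.X * (2 * RatFun.X + 1))

/-- The coefficient of `σ⁻¹` in the image of `v`. -/
noncomputable def coeffB (q : ℂ[X]) : RatFun :=
  aeval (-RatFun.X) q / (RatFun.X * (2 * RatFun.X - 1))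

/-- The constant coefficient in the image of `v`. -/
noncomputable def coeffG (q : ℂ[X]) : RatFun :=
  2 * algebraMap ℂ RatFun (rho q) / (1 - 4 * RatFun.X ^ 2)

/-- The image of `u` in the difference operators. -/
noncomputable def opU : ShiftAlgebra := penta 0 0 0 0 (RatFun.X ^ 2)

/-- The image of `v` in the difference operators. -/
noncomputable def opV (q : ℂ[X]) : ShiftAlgebra := penta 0 0 (coeffA q) (coeffB q) (coeffG q)

/-- The image of `w` in the difference operators. -/
noncomputable def opW (q : ℂ[X]) : ShiftAlgebra :=
  penta 0 0 (-(RatFun.X + 1) * coeffA q) ((RatFun.X - 1) * coeffB q) (-coeffG q / 2)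

theorem X_ne : RatFun.X ≠ 0 := by
  simpa using RatFun.linear_ne_zero (a := 1) 0 (by norm_num)

theorem X_add_one_ne : RatFun.X + 1 ≠ 0 := by
  simpa using RatFun.linear_ne_zero (a := 1) 1 (by norm_num)

theorem X_sub_one_ne : RatFun.X - 1 ≠ 0 := by
  simpa [sub_eq_add_neg] using RatFun.linear_ne_zero (a := 1) (-1) (by norm_num)

theorem two_X_add_one_ne : 2 * RatFun.X + 1 ≠ 0 := by
  simpa using RatFun.linear_ne_zero (a := 2) 1 (by norm_num)

theorem two_X_sub_one_ne : 2 * RatFun.X - 1 ≠ 0 := by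
  simpa [sub_eq_add_neg] using RatFun.linear_ne_zero (a := 2) (-1) (by norm_num)

theorem two_X_add_three_ne : 2 * RatFun.X + 3 ≠ 0 := by
  simpa using RatFun.linear_ne_zero (a := 2) 3 (by norm_num)

theorem two_X_sub_three_ne : 2 * RatFun.X - 3 ≠ 0 := by
  simpa [sub_eq_add_neg] using RatFun.linear_ne_zero (a := 2) (-3) (by norm_num)

theorem one_sub_ne : 1 - 4 * RatFun.X ^ 2 ≠ 0 := by
  rw [show 1 - 4 * RatFun.X ^ 2 = -((2 * RatFun.X + 1) * (2 * RatFun.X - 1)) by ring]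
  exact neg_ne_zero.mpr (mul_ne_zero two_X_add_one_ne two_X_sub_one_ne)

theorem ratShift_aeval (m : ℤ) (q : ℂ[X]) (f : RatFun) :
    ratShift m (aeval f q) = aeval (ratShift m f) q :=
  (aeval_algHom_apply (ratShift m) f q).symm

theorem ratShift_coeffB (q : ℂ[X]) : ratShift 1 (coeffB q)
    = aeval (-RatFun.X - 1) q / ((RatFun.X + 1) * (2 * RatFun.X + 1)) := by
  simp only [coeffB, map_div₀, ratShift_aeval, map_mul, map_sub, map_neg, map_ofNat, map_one,
    ratShift_X, Int.cast_one]
  rw [neg_add', show 2 * (RatFun.X + 1) - 1 = 2 * RatFun.X + 1 by ring]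

theorem ratShift_coeffA (q : ℂ[X]) : ratShift (-1) (coeffA q)
    = aeval (RatFun.X - 1) q / ((RatFun.X - 1) * (2 * RatFun.X - 1)) := by
  simp only [coeffA, map_div₀, ratShift_aeval, map_mul, map_add, map_ofNat, map_one,
    ratShift_X, Int.cast_one, Int.cast_neg, ← sub_eq_add_neg]
  rw [show 2 * (RatFun.X - 1) + 1 = 2 * RatFun.X - 1 by ring]

theorem ratShift_coeffG (q : ℂ[X]) : ratShift 1 (coeffG q)
    = -(2 * algebraMap ℂ RatFun (rho q)) / ((2 * RatFun.X + 1) * (2 * RatFun.X + 3)) := by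
  simp only [coeffG, map_div₀, map_mul, map_sub, map_pow, map_ofNat, map_one, AlgHom.commutes,
    ratShift_X, Int.cast_one]
  rw [show 1 - 4 * (RatFun.X + 1) ^ 2 = -((2 * RatFun.X + 1) * (2 * RatFun.X + 3)) by ring,
    div_neg, neg_div]

theorem ratShift_neg_coeffG (q : ℂ[X]) : ratShift (-1) (coeffG q)
    = -(2 * algebraMap ℂ RatFun (rho q)) / ((2 * RatFun.X - 1) * (2 * RatFun.X - 3)) := by
  simp only [coeffG, map_div₀, map_mul, map_sub, map_pow, map_ofNat, map_one, AlgHom.commutes,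
    ratShift_X, Int.cast_neg, Int.cast_one]
  rw [show 1 - 4 * (RatFun.X + -1) ^ 2 = -((2 * RatFun.X - 1) * (2 * RatFun.X - 3)) by ring,
    div_neg, neg_div]

theorem coeffG_eq (q : ℂ[X]) : coeffG q
    = -(2 * algebraMap ℂ RatFun (rho q)) / ((2 * RatFun.X - 1) * (2 * RatFun.X + 1)) := by
  rw [coeffG, show 1 - 4 * RatFun.X ^ 2 = -((2 * RatFun.X - 1) * (2 * RatFun.X + 1)) by ring,
    div_neg, neg_div]

theorem aeval_p (q : ℂ[X]) (f : RatFun) :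
    (aeval (f ^ 2) (p0 q) + aeval (f ^ 2) (p1 q) * f) * (1 + 2 * f) ^ 2
      = -4 * aeval f q * aeval (-f - 1) q + algebraMap ℂ RatFun (rho q) ^ 2 := by
  have h := congrArg (aeval f) (p_mul q)
  rw [p_eq, numer] at h
  simp only [map_add, map_mul, map_pow, map_neg, map_ofNat, aeval_comp, aeval_X, map_one,
    map_sub, aeval_C] at h
  exact h

theorem aeval_p' (q : ℂ[X]) :
    (aeval (RatFun.X ^ 2) (p0 q) + aeval (RatFun.X ^ 2) (p1 q) * RatFun.X) * (2 * RatFun.X + 1) ^ 2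
      = -4 * aeval RatFun.X q * aeval (-RatFun.X - 1) q + algebraMap ℂ RatFun (rho q) ^ 2 := by
  rw [← aeval_p, add_comm 1]

theorem aeval_neg_p (q : ℂ[X]) :
    (aeval (RatFun.X ^ 2) (p0 q) - aeval (RatFun.X ^ 2) (p1 q) * RatFun.X) * (2 * RatFun.X - 1) ^ 2
      = -4 * aeval (-RatFun.X) q * aeval (RatFun.X - 1) q + algebraMap ℂ RatFun (rho q) ^ 2 := by
  have h := aeval_p q (-RatFun.X)
  rw [neg_neg, neg_sq] at h
  rw [← h]
  ring

theorem aeval_opU (q : ℂ[X]) : aeval opU q = penta 0 0 0 0 (aeval (RatFun.X ^ 2) q) := by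
  rw [opU, ← const_eq_penta, ← const_eq_penta, aeval_algHom_apply]

theorem algebraMap_eq_penta (r : ℂ) :
    algebraMap ℂ ShiftAlgebra r = penta 0 0 0 0 (algebraMap ℂ RatFun r) := by
  rw [← const_eq_penta, AlgHom.commutes]

theorem two_eq_const : (2 : ShiftAlgebra) = const 2 := (map_ofNat const 2).symm

/-- Commuting with x² multiplies the coefficients of σ and σ⁻¹ by -(2x+1) and 2x-1 and kills the
constant term. The relation is thus equivalent to the chosen coefficients of `opW`. -/
theorem op_uv (q : ℂ[X]) : opU * opV q - opV q * opU = 2 * opW q + opV q := by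
  rw [two_eq_const, opU, opV, opW, penta_mul_penta, penta_mul_penta, const_mul_penta,
    penta_sub, penta_add]
  simp only [map_pow, ratShift_X, map_zero]
  push_cast
  congr 1 <;> ring

theorem op_uw (q : ℂ[X]) : opU * opW q - opW q * opU
    = 2 * (opV q * opU) + opW q + algebraMap ℂ _ (rho q) := by
  rw [two_eq_const, algebraMap_eq_penta, opU, opV, opW]
  simp only [penta_mul_penta, const_mul_penta, penta_sub, penta_add, map_pow, ratShift_X, map_zero]
  push_cast
  congr 1
  · ring
  · ring
  · ring
  · ring
  -- The constant term reads 0 = 2x²G - G/2 + ρ, which is the equation defining G.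
  · have h : coeffG q * (1 - 4 * RatFun.X ^ 2) = 2 * algebraMap ℂ RatFun (rho q) :=
      div_mul_cancel₀ _ one_sub_ne
    linear_combination (1 / 2 : RatFun) * h

theorem op_vw (q : ℂ[X]) : opV q * opW q - opW q * opV q
    = -opV q ^ 2 - aeval opU (p1 q) := by
  have hx := X_ne
  have h1 := X_add_one_ne
  have h2 := X_sub_one_ne
  have h3 := two_X_add_one_ne
  have h4 := two_X_sub_one_ne
  have h5 := two_X_add_three_ne
  have h6 := two_X_sub_three_ne
  have h3' := h3
  have h4' := h4
  have h5' := h5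
  have h6' := h6
  rw [mul_comm] at h3' h4' h5' h6'
  rw [aeval_opU, odd_part_eq hx h3 h4 (aeval_p' q) (aeval_neg_p q), opV, opW, sq]
  simp only [penta_mul_penta, penta_sub, penta_neg, map_mul, map_div₀,
    map_neg, map_add, map_sub, map_one, map_ofNat, ratShift_X, ratShift_coeffB, ratShift_coeffA,
    ratShift_coeffG, ratShift_neg_coeffG, Int.cast_one, Int.cast_neg]
  -- The coefficients of σ², σ⁻², σ, σ⁻¹ and 1 are compared. The polynomial p₁ enters only the last
  -- one, through q(x) q(-x-1) and q(-x) q(x-1).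
  congr 1
  · ring
  · ring
  · rw [coeffG_eq]; field_simp; ring
  · rw [coeffG_eq]; field_simp; ring
  · rw [coeffG_eq, coeffA, coeffB]; field_simp; ring

theorem op_ww (q : ℂ[X]) : opW q ^ 2
    = opV q ^ 2 * opU + opV q * opW q + rho q • opV q + aeval opU (p0 q) := by
  have hx := X_ne
  have h1 := X_add_one_ne
  have h2 := X_sub_one_ne
  have h3 := two_X_add_one_ne
  have h4 := two_X_sub_one_ne
  have h5 := two_X_add_three_ne
  have h6 := two_X_sub_three_ne
  have h3' := h3
  have h4' := h4
  have h5' := h5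
  have h6' := h6
  rw [mul_comm] at h3' h4' h5' h6'
  rw [aeval_opU, even_part_eq h3 h4 (aeval_p' q) (aeval_neg_p q), Algebra.smul_def,
    algebraMap_eq_penta, opV, opU, opW, sq, sq, mul_assoc]
  simp only [penta_mul_penta, penta_add, map_mul, map_div₀, map_pow, map_zero,
    map_neg, map_add, map_sub, map_one, map_ofNat, ratShift_X, ratShift_coeffB, ratShift_coeffA,
    ratShift_coeffG, ratShift_neg_coeffG, Int.cast_one, Int.cast_neg, mul_zero, zero_mul,
    add_zero, zero_add]
  congr 1
  · ring
  · ring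
  · rw [coeffG_eq]; field_simp; ring
  · rw [coeffG_eq]; field_simp; ring
  · rw [coeffG_eq, coeffA, coeffB]; field_simp; ring

end KleinianD

theorem weightFiltration.aeval_mem {k A ι : Type*} [Field k] [Ring A] [Algebra k A] (g : ι → A)
    (wt : ι → ℕ) {m n : ℕ} {x : A} (hx : x ∈ weightFiltration k g wt m) (r : k[X])
    (h : r.natDegree * m ≤ n) : aeval x r ∈ weightFiltration k g wt n := by
  rw [aeval_eq_sum_range]
  refine sum_mem fun i hi => Submodule.smul_mem _ _ (mono g wt ?_ (pow_mem g wt hx i))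
  exact (Nat.mul_le_mul_right m (Nat.lt_succ_iff.mp (Finset.mem_range.mp hi))).trans h

/-! ### Degree and leading coefficient in σ -/

namespace ShiftAlgebra

/-- The difference operators of degree at most `n`. -/
def DegLE (n : ℤ) (f : ShiftAlgebra) : Prop :=
  ∀ i : ℤ, f.coeff (Multiplicative.ofAdd i) ≠ 0 → i ≤ n

variable {m n : ℤ} {f g : ShiftAlgebra}

theorem DegLE.mono (hf : DegLE m f) (h : m ≤ n) : DegLE n f := fun i hi => (hf i hi).trans h

theorem DegLE.coeff_eq_zero (hf : DegLE m f) (h : m < n) :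
    f.coeff (Multiplicative.ofAdd n) = 0 := by
  by_contra h'
  exact absurd (hf n h') (not_le.mpr h)

theorem DegLE.add (hf : DegLE m f) (hg : DegLE m g) : DegLE m (f + g) := by
  intro i hi
  by_contra! h
  exact hi (by rw [SkewMonoidAlgebra.coeff_add, Finsupp.add_apply, hf.coeff_eq_zero h,
    hg.coeff_eq_zero h, add_zero])

theorem degLE_zero : DegLE m 0 := fun _ hi => absurd rfl hi

theorem degLE_term (a : RatFun) : DegLE n (term n a) := fun i hi => by
  rw [coeff_term] at hi
  by_contra! h
  exact hi (if_neg h.ne)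

theorem DegLE.smul (c : ℂ) (hf : DegLE m f) : DegLE m (c • f) := fun i hi =>
  hf i fun h => hi (by rw [SkewMonoidAlgebra.coeff_smul, Finsupp.smul_apply, h, smul_zero])

theorem DegLE.mul (hf : DegLE m f) (hg : DegLE n g) : DegLE (m + n) (f * g) := by
  classical
  intro i hi
  obtain ⟨a, ha, b, hb, hab⟩ := Finset.mem_mul.mp
    (SkewMonoidAlgebra.support_mul f g (SkewMonoidAlgebra.mem_support_iff.mpr hi))
  have h1 := hf a.toAdd (SkewMonoidAlgebra.mem_support_iff.mp ha)
  have h2 := hg b.toAdd (SkewMonoidAlgebra.mem_support_iff.mp hb)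
  have h3 : a.toAdd + b.toAdd = i := congrArg Multiplicative.toAdd hab
  omega

/-- Only the two top terms can meet in degree m + n, so leading coefficients multiply up to a shift.
-/
theorem DegLE.coeff_mul (hf : DegLE m f) (hg : DegLE n g) :
    (f * g).coeff (Multiplicative.ofAdd (m + n)) = f.coeff (Multiplicative.ofAdd m)
      * ratShift m (g.coeff (Multiplicative.ofAdd n)) := by
  refine SkewMonoidAlgebra.coeff_mul_of_uniqueMul fun a b ha hb hab => ?_
  have h1 := hf a.toAdd (SkewMonoidAlgebra.mem_support_iff.mp ha)
  have h2 := hg b.toAdd (SkewMonoidAlgebra.mem_support_iff.mp hb)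
  have h3 : a.toAdd + b.toAdd = m + n := congrArg Multiplicative.toAdd hab
  exact ⟨Multiplicative.toAdd.injective (show a.toAdd = m by omega),
    Multiplicative.toAdd.injective (show b.toAdd = n by omega)⟩

theorem degLE_penta (c d e : RatFun) : DegLE 1 (penta 0 0 c d e) := by
  simp only [penta, term_zero_right, zero_add]
  exact ((degLE_term c).add ((degLE_term d).mono (by norm_num))).add
    ((degLE_term e).mono (by norm_num))

theorem coeff_penta (c d e : RatFun) :
    (penta 0 0 c d e).coeff (Multiplicative.ofAdd 1) = c := by
  simp only [penta, term_zero_right, zero_add, SkewMonoidAlgebra.coeff_add, Finsupp.add_apply,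
    coeff_term]
  simp

theorem degLE_penta_zero (e : RatFun) : DegLE 0 (penta 0 0 0 0 e) := by
  rw [← const_eq_penta]
  exact degLE_term e

theorem coeff_penta_zero (e : RatFun) :
    (penta 0 0 0 0 e).coeff (Multiplicative.ofAdd 0) = e := by
  rw [← const_eq_penta, const_apply, coeff_term, if_pos rfl]

end ShiftAlgebra

/-- Parity of degrees: the left side has even degree, the right side odd degree unless b = 0. -/
theorem Polynomial.eq_zero_of_comp_sq_eq {K : Type*} [Field K] {a b : K[X]} (c : K)
    (h : a.comp (X ^ 2) = (X + C c) * b.comp (X ^ 2)) : a = 0 ∧ b = 0 := by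
  rw [← expand_eq_comp_X_pow, ← expand_eq_comp_X_pow] at h
  have hb : b = 0 := by
    by_contra hb
    have hb' : expand K 2 b ≠ 0 := (expand_ne_zero two_pos).mpr hb
    have := congrArg natDegree h
    rw [natDegree_mul (X_add_C_ne_zero c) hb', natDegree_X_add_C, natDegree_expand,
      natDegree_expand] at this
    omega
  subst hb
  rw [map_zero, mul_zero] at h
  exact ⟨(expand_eq_zero two_pos).mp h, rfl⟩

/-! ### Weights, normal monomials and faithfulness for D(q) -/

namespace KleinianD

open ShiftAlgebra

variable (q : ℂ[X])

theorem map_two {B : Type*} [Ring B] [Algebra ℂ B] (f : FreeAlgebra ℂ Gen →ₐ[ℂ] B) :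
    f (2 : FreeAlgebra ℂ Gen) = 2 := by
  rw [← one_add_one_eq_two, map_add, map_one, one_add_one_eq_two]

/-- The generators of `D(q)`. -/
noncomputable def gen : Fin 3 → KleinianDAlgebra q :=
  ![RingQuot.mkAlgHom ℂ (Rel q) u, RingQuot.mkAlgHom ℂ (Rel q) v, RingQuot.mkAlgHom ℂ (Rel q) w]

theorem gen_uv : gen q 0 * gen q 1 - gen q 1 * gen q 0 = 2 * gen q 2 + gen q 1 := by
  simpa [gen, map_two] using RingQuot.mkAlgHom_rel ℂ (Rel.uv (q := q))

theorem gen_uw : gen q 0 * gen q 2 - gen q 2 * gen q 0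
    = 2 * (gen q 1 * gen q 0) + gen q 2 + algebraMap ℂ _ (rho q) := by
  simpa [gen, map_two] using RingQuot.mkAlgHom_rel ℂ (Rel.uw (q := q))

theorem gen_vw : gen q 1 * gen q 2 - gen q 2 * gen q 1
    = -gen q 1 ^ 2 - aeval (gen q 0) (p1 q) := by
  simpa [gen, ← aeval_algHom_apply] using RingQuot.mkAlgHom_rel ℂ (Rel.vw (q := q))

theorem gen_ww : gen q 2 ^ 2 = gen q 1 ^ 2 * gen q 0 + gen q 1 * gen q 2 + rho q • gen q 1
    + aeval (gen q 0) (p0 q) := by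
  simpa [gen, ← aeval_algHom_apply] using RingQuot.mkAlgHom_rel ℂ (Rel.ww (q := q))

theorem adjoin_gen : Algebra.adjoin ℂ (Set.range (gen q)) = ⊤ := by
  have h : Set.range (gen q) = RingQuot.mkAlgHom ℂ (Rel q) '' Set.range (FreeAlgebra.ι ℂ) := by
    ext x
    simp only [Set.mem_range, Set.mem_image, exists_exists_eq_and]
    constructor
    · rintro ⟨i, rfl⟩
      fin_cases i
      exacts [⟨Gen.u, rfl⟩, ⟨Gen.v, rfl⟩, ⟨Gen.w, rfl⟩]
    · rintro ⟨g, rfl⟩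
      cases g
      exacts [⟨0, rfl⟩, ⟨1, rfl⟩, ⟨2, rfl⟩]
  rw [h, ← AlgHom.map_adjoin, FreeAlgebra.adjoin_range_ι, Algebra.map_top]
  exact (AlgHom.range_eq_top _).mpr (RingQuot.mkAlgHom_surjective ℂ (Rel q))

/-- The representation of `D(q)` by difference operators. -/
noncomputable def rep : KleinianDAlgebra q →ₐ[ℂ] ShiftAlgebra :=
  RingQuot.liftAlgHom ℂ ⟨FreeAlgebra.lift ℂ fun g => match g with
    | Gen.u => opU
    | Gen.v => opV q
    | Gen.w => opW q, by
      rintro _ _ (_ | _ | _ | _)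
      · simpa [map_two] using op_uv q
      · simpa [map_two] using op_uw q
      · simpa [← aeval_algHom_apply] using op_vw q
      · simpa [← aeval_algHom_apply] using op_ww q⟩

theorem rep_u : rep q (gen q 0) = opU := by simp [rep, gen]
theorem rep_v : rep q (gen q 1) = opV q := by simp [rep, gen]
theorem rep_w : rep q (gen q 2) = opW q := by simp [rep, gen]

/-- Half of the weight of the generator `v`, large enough for the filtration by weight. -/
noncomputable def halfWeight : ℕ := (p0 q).natDegree + (p1 q).natDegree + 1

/-- The weights of the generators. -/
noncomputable def weight : Fin 3 → ℕ := ![2, 2 * halfWeight q, 2 * halfWeight q + 1]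

theorem weight_pos (i : Fin 3) : 0 < weight q i := by
  fin_cases i <;> simp [weight, halfWeight]

/-- The filtration of `D(q)` by weight. -/
noncomputable abbrev filtration (n : ℕ) : Submodule ℂ (KleinianDAlgebra q) :=
  weightFiltration ℂ (gen q) (weight q) n

theorem gen_mem (i : Fin 3) : gen q i ∈ filtration q (weight q i) :=
  weightFiltration.gen_mem _ _ i

/-- With d = `halfWeight q`, the weights 2, 2d, 2d+1 are just sufficient: w in [u,v], vu in [u,w]
and v² in [v,w] each lie exactly one below the weight of the product. The term p₁(u) fits because d
exceeds the degree of p₁. -/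
theorem commutator_gen_mem (i j : Fin 3) (n : ℕ) (h : weight q i + weight q j = n + 1) :
    gen q i * gen q j - gen q j * gen q i ∈ filtration q n := by
  have hd : 1 ≤ halfWeight q := by simp [halfWeight]
  have hu := gen_mem q 0
  have hv := gen_mem q 1
  have hw := gen_mem q 2
  have mono := weightFiltration.mono (k := ℂ) (gen q) (weight q)
  have w0 : weight q 0 = 2 := rfl
  have w1 : weight q 1 = 2 * halfWeight q := rfl
  have w2 : weight q 2 = 2 * halfWeight q + 1 := rfl
  have two_mul_mem : ∀ {x n}, x ∈ filtration q n → 2 * x ∈ filtration q n := fun hx => by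
    rw [two_mul]; exact add_mem hx hx
  have uv : ∀ n, weight q 0 + weight q 1 = n + 1 →
      gen q 0 * gen q 1 - gen q 1 * gen q 0 ∈ filtration q n := fun n h => by
    rw [gen_uv]
    exact add_mem (two_mul_mem (mono (by omega) hw)) (mono (by omega) hv)
  have uw : ∀ n, weight q 0 + weight q 2 = n + 1 →
      gen q 0 * gen q 2 - gen q 2 * gen q 0 ∈ filtration q n := fun n h => by
    rw [gen_uw, Algebra.algebraMap_eq_smul_one]
    exact add_mem (add_mem (two_mul_mem (weightFiltration.mul_mem_of_le _ _ hv hu (by omega)))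
      (mono (by omega) hw)) (Submodule.smul_mem _ _ (weightFiltration.one_mem _ _ _))
  have vw : ∀ n, weight q 1 + weight q 2 = n + 1 →
      gen q 1 * gen q 2 - gen q 2 * gen q 1 ∈ filtration q n := fun n h => by
    rw [gen_vw]
    refine sub_mem (neg_mem (mono ?_ (weightFiltration.pow_mem _ _ hv 2)))
      (weightFiltration.aeval_mem _ _ hu _ ?_)
    · omega
    · have : halfWeight q = (p0 q).natDegree + (p1 q).natDegree + 1 := rfl
      rw [w0]
      omega
  have swap : ∀ i j : Fin 3, gen q i * gen q j - gen q j * gen q i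
      = -(gen q j * gen q i - gen q i * gen q j) := fun i j => (neg_sub _ _).symm
  have hi : i = 0 ∨ i = 1 ∨ i = 2 := by omega
  have hj : j = 0 ∨ j = 1 ∨ j = 2 := by omega
  rcases hi with rfl | rfl | rfl <;> rcases hj with rfl | rfl | rfl
  · simp
  · exact uv n h
  · exact uw n h
  · rw [swap]; exact neg_mem (uv n (by omega))
  · simp
  · exact vw n h
  · rw [swap]; exact neg_mem (uw n (by omega))
  · rw [swap]; exact neg_mem (vw n (by omega))
  · simp

/-- The span of the normal monomials `uⁱ vʲ wᵋ`, `ε ≤ 1`, with `j + ε ≤ N`. -/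
noncomputable def normalSpan (N : ℕ) : Submodule ℂ (KleinianDAlgebra q) :=
  Submodule.span ℂ {x | ∃ i j e : ℕ,
    e ≤ 1 ∧ j + e ≤ N ∧ gen q 0 ^ i * gen q 1 ^ j * gen q 2 ^ e = x}

theorem normalSpan_mono : Monotone (normalSpan q) := fun _ _ h =>
  Submodule.span_mono (by rintro _ ⟨i, j, e, he, hj, rfl⟩; exact ⟨i, j, e, he, hj.trans h, rfl⟩)

theorem exists_mem_normalSpan_add {x y : KleinianDAlgebra q} (hx : ∃ N, x ∈ normalSpan q N)
    (hy : ∃ N, y ∈ normalSpan q N) : ∃ N, x + y ∈ normalSpan q N := by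
  obtain ⟨M, hM⟩ := hx
  obtain ⟨N, hN⟩ := hy
  exact ⟨M + N, add_mem (normalSpan_mono q (by omega) hM) (normalSpan_mono q (by omega) hN)⟩

/-- In w² = v²u + …, both w² and v²u have weight 4d+2 and the remaining terms at most 4d+1.
Replacing w² by v²u therefore keeps the leading weight and lowers the exponent of w; the outer
induction is on the weight, the inner one on that exponent. -/
theorem exists_mem_normalSpan_of_mem_filtration (n : ℕ) :
    ∀ x ∈ filtration q n, ∃ N, x ∈ normalSpan q N := by
  have w0 : weight q 0 = 2 := rfl
  have w1 : weight q 1 = 2 * halfWeight q := rfl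
  have w2 : weight q 2 = 2 * halfWeight q + 1 := rfl
  have hd : halfWeight q = (p0 q).natDegree + (p1 q).natDegree + 1 := rfl
  have hu := gen_mem q 0
  have hv := gen_mem q 1
  have hw := gen_mem q 2
  have mono := weightFiltration.mono (k := ℂ) (gen q) (weight q)
  have hE : gen q 2 ^ 2 - gen q 1 ^ 2 * gen q 0 ∈ filtration q (4 * halfWeight q + 1) := by
    rw [gen_ww, show ∀ a b c d : KleinianDAlgebra q, a + b + c + d - a = b + c + d by
      intros; abel]
    refine add_mem (add_mem (weightFiltration.mul_mem_of_le _ _ hv hw ?_)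
      (Submodule.smul_mem _ _ (mono ?_ hv))) (weightFiltration.aeval_mem _ _ hu _ ?_)
    · omega
    · omega
    · rw [w0]; omega
  induction n using Nat.strong_induction_on with
  | _ n ih =>
  intro x hx
  replace hx := weightFiltration.le_span_monomials (weight_pos q) (commutator_gen_mem q) n hx
  induction hx using Submodule.span_induction with
  | zero => exact ⟨0, zero_mem _⟩
  | add x y _ _ hx hy => exact exists_mem_normalSpan_add q hx hy
  | smul a x _ hx => exact hx.imp fun N h => Submodule.smul_mem _ _ h
  | mem x hx =>
    obtain ⟨a, b, c, h, rfl⟩ := hx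
    induction c using Nat.strong_induction_on generalizing a b with
    | _ c ihc =>
    by_cases hc : c ≤ 1
    · exact ⟨b + c, Submodule.subset_span ⟨a, b, c, hc, le_rfl, rfl⟩⟩
    obtain ⟨c, rfl⟩ : ∃ c', c = c' + 2 := ⟨c - 2, by omega⟩
    have ha := weightFiltration.pow_mem _ _ hu a
    have hb := weightFiltration.pow_mem _ _ hv b
    have hc := weightFiltration.pow_mem _ _ hw c
    -- One w² is replaced by v²u and its u is moved to the front. The first term has the same weight
    -- and two factors w fewer; the commutator and the error term of w² have weight at most n - 1.
    have e : gen q 0 ^ a * gen q 1 ^ b * gen q 2 ^ (c + 2)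
        = gen q 0 ^ (a + 1) * gen q 1 ^ (b + 2) * gen q 2 ^ c
          + (gen q 0 ^ a * (gen q 1 ^ (b + 2) * gen q 0 - gen q 0 * gen q 1 ^ (b + 2))
              * gen q 2 ^ c
            + gen q 0 ^ a * gen q 1 ^ b * (gen q 2 ^ 2 - gen q 1 ^ 2 * gen q 0) * gen q 2 ^ c) := by
      rw [pow_add (gen q 1), pow_succ (gen q 0), add_comm c 2, pow_add (gen q 2)]
      simp only [mul_sub, sub_mul, mul_assoc]
      abel
    rw [e]
    have e1 : (c + 2) * weight q 2 = c * weight q 2 + 2 * weight q 2 := add_mul _ _ _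
    have e2 : (b + 2) * weight q 1 = b * weight q 1 + 2 * weight q 1 := add_mul _ _ _
    have e3 : (a + 1) * weight q 0 = a * weight q 0 + weight q 0 := Nat.succ_mul _ _
    refine exists_mem_normalSpan_add q (ihc c (by omega) _ _ (by omega))
      (ih (n - 1) (by omega) _ (add_mem ?_ ?_))
    · refine weightFiltration.mul_mem_of_le _ _ (weightFiltration.mul_mem _ _ ha
        (weightFiltration.commutator_mem (weight_pos q) (commutator_gen_mem q)
          (r := (b + 2) * weight q 1 + 1) (weightFiltration.pow_mem _ _ hv (b + 2)) hu
          (by omega))) hc (by omega)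
    · exact weightFiltration.mul_mem_of_le _ _ (weightFiltration.mul_mem _ _
        (weightFiltration.mul_mem _ _ ha hb) hE) hc (by omega)

theorem exists_mem_normalSpan (x : KleinianDAlgebra q) : ∃ N, x ∈ normalSpan q N := by
  obtain ⟨n, hn⟩ := weightFiltration.exists_mem (gen q) (weight q) (adjoin_gen q) x
  exact exists_mem_normalSpan_of_mem_filtration q n x hn

theorem exists_eq_of_mem_normalSpan_zero {x : KleinianDAlgebra q} (hx : x ∈ normalSpan q 0) :
    ∃ a : ℂ[X], x = aeval (gen q 0) a := by
  induction hx using Submodule.span_induction with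
  | zero => exact ⟨0, by simp⟩
  | add x y _ _ hx hy =>
    obtain ⟨a, rfl⟩ := hx
    obtain ⟨b, rfl⟩ := hy
    exact ⟨a + b, by simp⟩
  | smul c x _ hx =>
    obtain ⟨a, rfl⟩ := hx
    exact ⟨c • a, by simp⟩
  | mem x hx =>
    obtain ⟨i, j, e, -, h, rfl⟩ := hx
    obtain ⟨rfl, rfl⟩ : j = 0 ∧ e = 0 := by omega
    exact ⟨X ^ i, by simp⟩

theorem exists_eq_of_mem_normalSpan_succ {N : ℕ} {x : KleinianDAlgebra q}
    (hx : x ∈ normalSpan q (N + 1)) : ∃ y ∈ normalSpan q N, ∃ a b : ℂ[X],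
      x = y + (aeval (gen q 0) a * gen q 1 ^ (N + 1)
        + aeval (gen q 0) b * gen q 1 ^ N * gen q 2) := by
  induction hx using Submodule.span_induction with
  | zero => exact ⟨0, zero_mem _, 0, 0, by simp⟩
  | add x y _ _ hx hy =>
    obtain ⟨x', hx', a, b, rfl⟩ := hx
    obtain ⟨y', hy', a', b', rfl⟩ := hy
    exact ⟨x' + y', add_mem hx' hy', a + a', b + b', by simp only [map_add, add_mul]; abel⟩
  | smul c x _ hx =>
    obtain ⟨x', hx', a, b, rfl⟩ := hx
    exact ⟨c • x', Submodule.smul_mem _ _ hx', c • a, c • b, by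
      simp only [map_smul, smul_add, smul_mul_assoc]⟩
  | mem x hx =>
    obtain ⟨i, j, e, he, h, rfl⟩ := hx
    by_cases hj : j + e ≤ N
    · exact ⟨_, Submodule.subset_span ⟨i, j, e, he, hj, rfl⟩, 0, 0, by simp⟩
    · obtain ⟨rfl, rfl⟩ | ⟨rfl, rfl⟩ : (e = 0 ∧ j = N + 1) ∨ (e = 1 ∧ j = N) := by omega
      · exact ⟨0, zero_mem _, X ^ i, 0, by simp⟩
      · exact ⟨0, zero_mem _, 0, X ^ i, by simp⟩

theorem degLE_opV_pow (N : ℕ) : DegLE N (opV q ^ N) := by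
  induction N with
  | zero => rw [pow_zero, one_eq_term]; exact degLE_term 1
  | succ N ih => rw [pow_succ]; push_cast; exact ih.mul (degLE_penta _ _ _)

theorem degLE_aeval_opU (a : ℂ[X]) : DegLE 0 (aeval opU a) := by
  rw [aeval_opU]; exact degLE_penta_zero _

theorem coeff_aeval_opU (a : ℂ[X]) :
    (aeval opU a).coeff (Multiplicative.ofAdd 0) = aeval (RatFun.X ^ 2) a := by
  rw [aeval_opU, coeff_penta_zero]

theorem degLE_rep {N : ℕ} {x : KleinianDAlgebra q} (hx : x ∈ normalSpan q N) :
    DegLE N (rep q x) := by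
  induction hx using Submodule.span_induction with
  | zero => rw [map_zero]; exact degLE_zero
  | add x y _ _ hx hy => rw [map_add]; exact hx.add hy
  | smul c x _ hx => rw [map_smul]; exact hx.smul c
  | mem x hx =>
    obtain ⟨i, j, e, he, h, rfl⟩ := hx
    have hU : DegLE 0 (rep q (gen q 0 ^ i)) := by
      rw [← aeval_X (R := ℂ) (gen q 0), ← map_pow, ← aeval_algHom_apply, rep_u]
      exact degLE_aeval_opU _
    have hW : DegLE e (rep q (gen q 2 ^ e)) := by
      obtain rfl | rfl : e = 0 ∨ e = 1 := by omega
      · rw [pow_zero, map_one, one_eq_term]; exact degLE_term 1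
      · rw [pow_one, rep_w]; exact degLE_penta _ _ _
    rw [map_mul, map_mul, map_pow _ (gen q 1), rep_v]
    exact ((hU.mul (degLE_opV_pow q j)).mul hW).mono (by omega)

variable {q}

theorem coeffA_ne_zero (hq : q ≠ 0) : coeffA q ≠ 0 := by
  refine div_ne_zero ?_ (mul_ne_zero X_ne two_X_add_one_ne)
  rw [RatFun.X, aeval_algebraMap_apply, aeval_X_left_apply]
  exact (map_ne_zero_iff _ (IsFractionRing.injective ℂ[X] RatFun)).mpr hq

theorem coeff_opV_pow_succ (N : ℕ) :
    (opV q ^ (N + 1)).coeff (Multiplicative.ofAdd ((N : ℤ) + 1))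
      = (opV q ^ N).coeff (Multiplicative.ofAdd (N : ℤ)) * ratShift N (coeffA q) := by
  have h := (degLE_opV_pow q N).coeff_mul (degLE_penta (coeffA q) (coeffB q) (coeffG q))
  rwa [coeff_penta, ← opV, ← pow_succ] at h

theorem coeff_opV_pow_ne_zero (hq : q ≠ 0) (N : ℕ) :
    (opV q ^ N).coeff (Multiplicative.ofAdd (N : ℤ)) ≠ 0 := by
  induction N with
  | zero =>
    rw [pow_zero, one_eq_term, Nat.cast_zero, coeff_term, if_pos rfl]
    exact one_ne_zero
  | succ N ih =>
    rw [Nat.cast_succ, coeff_opV_pow_succ]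
    exact mul_ne_zero ih (by simpa using coeffA_ne_zero hq)

theorem aeval_sq_eq (a : ℂ[X]) :
    aeval (RatFun.X ^ 2) a = algebraMap ℂ[X] RatFun (a.comp (X ^ 2)) := by
  rw [RatFun.X, ← map_pow, aeval_algebraMap_apply, comp_eq_aeval]

/-- Induction on the degree N in v and w. The part of degree N + 1, a(u) v^(N+1) + b(u) v^N w, has
σ^(N+1)-coefficient P·A(x+N)·(a(x²) - (x+N+1) b(x²)), with P the leading coefficient of the image of
v^N. Its vanishing forces a = b = 0 by parity. -/
theorem rep_injective (hq : q ≠ 0) : Function.Injective (rep q) := by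
  rw [injective_iff_map_eq_zero]
  intro x hx
  obtain ⟨N, hN⟩ := exists_mem_normalSpan q x
  induction N generalizing x with
  | zero =>
    obtain ⟨a, rfl⟩ := exists_eq_of_mem_normalSpan_zero q hN
    rw [← aeval_algHom_apply, rep_u] at hx
    have h := coeff_aeval_opU a
    rw [hx, aeval_sq_eq] at h
    have h' : a.comp (X ^ 2) = 0 := by
      apply IsFractionRing.injective ℂ[X] RatFun
      exact h.symm.trans (map_zero (algebraMap ℂ[X] RatFun)).symm
    have ha : a = 0 :=
      (Polynomial.eq_zero_of_comp_sq_eq (b := 0) (0 : ℂ) (by simpa using h')).1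
    rw [ha, map_zero]
  | succ N ih =>
    obtain ⟨y, hy, a, b, rfl⟩ := exists_eq_of_mem_normalSpan_succ q hN
    have h := congrArg (fun f => f.coeff (Multiplicative.ofAdd ((N : ℤ) + 1))) hx
    simp only [map_add, map_mul, map_pow, ← aeval_algHom_apply, rep_u, rep_v, rep_w,
      SkewMonoidAlgebra.coeff_add, Finsupp.add_apply, SkewMonoidAlgebra.coeff_zero,
      Finsupp.zero_apply] at h
    have h1 := (degLE_aeval_opU a).coeff_mul (degLE_opV_pow q (N + 1))
    have h2 := ((degLE_aeval_opU b).mul (degLE_opV_pow q N)).coeff_mul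
      (degLE_penta (-(RatFun.X + 1) * coeffA q) ((RatFun.X - 1) * coeffB q) (-coeffG q / 2))
    rw [(degLE_aeval_opU b).coeff_mul (degLE_opV_pow q N)] at h2
    rw [zero_add, ratShift_zero] at h1 h2
    rw [coeff_aeval_opU] at h1 h2
    rw [coeff_penta] at h2
    rw [Nat.cast_succ, coeff_opV_pow_succ] at h1
    -- The image of y has degree at most N in σ, so only the two top terms contribute.
    rw [(degLE_rep q hy).coeff_eq_zero (by omega), h1, opW, h2, zero_add, map_mul, map_neg, map_add,
      ratShift_X, map_one] at h
    set P := (opV q ^ N).coeff (Multiplicative.ofAdd (N : ℤ)) with hP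
    set A := ratShift N (coeffA q) with hA
    have hA0 : A ≠ 0 := by simpa [hA] using coeffA_ne_zero hq
    have h' : P * A * (aeval (RatFun.X ^ 2) a
        - (RatFun.X + ((N : ℤ) : RatFun) + 1) * aeval (RatFun.X ^ 2) b) = 0 := by
      rw [← h]; ring
    have h3 := sub_eq_zero.mp
      ((mul_eq_zero.mp h').resolve_left (mul_ne_zero (coeff_opV_pow_ne_zero hq N) hA0))
    have h4 : a.comp (X ^ 2) = (X + C ((N : ℂ) + 1)) * b.comp (X ^ 2) := by
      apply IsFractionRing.injective ℂ[X] RatFun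
      rw [← aeval_sq_eq, h3, map_mul, ← aeval_sq_eq, RatFun.X]
      simp [add_assoc]
    obtain ⟨rfl, rfl⟩ := Polynomial.eq_zero_of_comp_sq_eq _ h4
    simp only [map_zero, zero_mul, add_zero] at hx ⊢
    exact ih y hx hy

theorem isDomain (hq : q ≠ 0) : IsDomain (KleinianDAlgebra q) :=
  (rep_injective hq).isDomain (rep q).toRingHom

theorem isOreDomain (hq : q ≠ 0) : IsOreDomain (KleinianDAlgebra q) :=
  have := isDomain hq
  weightFiltration.isOreDomain (weight_pos q) (commutator_gen_mem q) (adjoin_gen q)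

end KleinianD

/-! ### Weyl pairs -/

namespace WeylPair

theorem pow_mul_eq {R : Type*} [Ring R] {y z : R} (h : y * z - z * y = 1) (j : ℕ) :
    y ^ (j + 1) * z = z * y ^ (j + 1) + ((j + 1 : ℕ) : R) * y ^ j := by
  induction j with
  | zero => rw [zero_add, pow_one, sub_eq_iff_eq_add.mp h]; simp; abel
  | succ j ih =>
    rw [pow_succ', mul_assoc, ih, mul_add, ← mul_assoc, sub_eq_iff_eq_add.mp h,
      ← mul_assoc, ← Nat.cast_comm]
    push_cast
    rw [pow_succ' y j]
    noncomm_ring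

variable {R : Type*} [Ring R] [Algebra ℂ R] {y z : R}

theorem mul_aeval (h : y * z - z * y = 1) (a : ℂ[X]) :
    y * aeval z a = aeval z a * y + aeval z (derivative a) := by
  induction a using Polynomial.induction_on' with
  | add a b ha hb => simp only [map_add, mul_add, add_mul, ha, hb]; abel
  | monomial n c =>
    have key : y * z ^ n = z ^ n * y + (n : R) * z ^ (n - 1) := by
      induction n with
      | zero => simp
      | succ n ih =>
        rw [pow_succ, ← mul_assoc, ih, add_mul, mul_assoc, sub_eq_iff_eq_add.mp h, mul_assoc]
        rcases n with _ | n
        · simp; abel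
        · rw [Nat.add_sub_cancel, Nat.add_sub_cancel, ← pow_succ]
          push_cast
          noncomm_ring
    rw [aeval_monomial, derivative_monomial, aeval_monomial, ← mul_assoc, ← Algebra.commutes c y,
      mul_assoc, key, mul_add, map_mul, map_natCast]
    noncomm_ring

/-- Commutation with y differentiates a relation a(z) = 0. The derivative has smaller degree, so it
vanishes by induction; then a is a constant, hence zero. -/
theorem aeval_eq_zero [Nontrivial R] (h : y * z - z * y = 1) (a : ℂ[X]) (ha : aeval z a = 0) :
    a = 0 := by
  induction hn : a.natDegree using Nat.strong_induction_on generalizing a with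
  | _ n ih =>
  have hd : aeval z (derivative a) = 0 := by
    have := mul_aeval h a
    rwa [ha, mul_zero, zero_mul, zero_add, eq_comm] at this
  have h0 : a.natDegree = 0 := by
    by_contra hne
    have := ih _ (hn ▸ natDegree_derivative_lt hne) _ hd rfl
    exact hne (derivative_eq_zero.mp this)
  rw [eq_C_of_natDegree_eq_zero h0, aeval_C, map_eq_zero_iff _ (algebraMap ℂ R).injective] at ha
  rw [eq_C_of_natDegree_eq_zero h0, ha, C_0]

/-- The commutator with z acts as formal differentiation in y. It turns a relation of length N + 1
into one of length N with coefficients (j+1) a_{j+1}, and characteristic zero gives all but a₀. -/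
theorem sum_eq_zero [Nontrivial R] (h : y * z - z * y = 1) (N : ℕ) (a : ℕ → ℂ[X])
    (ha : ∑ j ∈ Finset.range N, aeval z (a j) * y ^ j = 0) : ∀ j < N, a j = 0 := by
  induction N generalizing a with
  | zero => intro j hj; omega
  | succ N ih =>
    have h1 : ∑ j ∈ Finset.range N, aeval z (((j + 1 : ℕ) : ℂ[X]) * a (j + 1)) * y ^ j = 0 := by
      have h2 : (∑ j ∈ Finset.range (N + 1), aeval z (a j) * y ^ j) * z
          - z * ∑ j ∈ Finset.range (N + 1), aeval z (a j) * y ^ j = 0 := by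
        rw [ha, zero_mul, mul_zero, sub_zero]
      rw [Finset.sum_mul, Finset.mul_sum, ← Finset.sum_sub_distrib, Finset.sum_range_succ'] at h2
      have hc : ∀ b : ℂ[X], z * aeval z b = aeval z b * z := fun b => by
        simpa using congrArg (aeval z) (mul_comm X b)
      rw [← h2, pow_zero, mul_one, hc, sub_self, add_zero]
      refine Finset.sum_congr rfl fun j _ => ?_
      rw [mul_assoc, pow_mul_eq h, ← mul_assoc z, hc, map_mul, map_natCast, mul_add, mul_assoc _ z,
        add_sub_cancel_left, ← mul_assoc, ← Nat.cast_comm]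
    have h3 : ∀ j < N, a (j + 1) = 0 := fun j hj =>
      (mul_eq_zero.mp (ih _ h1 j hj)).resolve_left (Nat.cast_ne_zero.mpr j.succ_ne_zero)
    rw [Finset.sum_range_succ', Finset.sum_eq_zero fun j hj => by
      rw [h3 j (Finset.mem_range.mp hj), map_zero, zero_mul], zero_add, pow_zero, mul_one] at ha
    rintro (_ | j) hj
    · exact aeval_eq_zero h _ ha
    · exact h3 j (by omega)

end WeylPair

/-! ### The first Weyl algebra: spanning monomials, embeddings, Ore condition -/

namespace WeylAlgebraOne

/-- The generators of the first Weyl algebra, and `1`. -/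
noncomputable def gen : Fin 3 → WeylAlgebraOne :=
  ![RingQuot.mkAlgHom ℂ WeylRel (FreeAlgebra.ι ℂ WeylGen.x),
    RingQuot.mkAlgHom ℂ WeylRel (FreeAlgebra.ι ℂ WeylGen.d), 1]

theorem gen_comm : gen 1 * gen 0 - gen 0 * gen 1 = 1 := by
  simpa [gen] using RingQuot.mkAlgHom_rel ℂ WeylRel.comm

theorem adjoin_gen : Algebra.adjoin ℂ (Set.range gen) = ⊤ := by
  refine top_le_iff.mp (le_trans ?_ (Algebra.adjoin_mono (R := ℂ)
    (s := RingQuot.mkAlgHom ℂ WeylRel '' Set.range (FreeAlgebra.ι ℂ)) ?_))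
  · rw [← AlgHom.map_adjoin, FreeAlgebra.adjoin_range_ι, Algebra.map_top]
    exact ((AlgHom.range_eq_top _).mpr (RingQuot.mkAlgHom_surjective ℂ WeylRel)).ge
  · rintro _ ⟨_, ⟨g, rfl⟩, rfl⟩
    cases g
    exacts [⟨0, rfl⟩, ⟨1, rfl⟩]

/-- The third generator 1 only serves to fit the criterion for three generators. All weights are 1,
and every commutator of generators is 0 or ±1. -/
theorem commutator_gen_mem (i j : Fin 3) (n : ℕ) (_ : (1 : ℕ) + 1 = n + 1) :
    gen i * gen j - gen j * gen i ∈ weightFiltration ℂ gen (fun _ => 1) n := by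
  have h1 := weightFiltration.one_mem (k := ℂ) gen (fun _ => 1) n
  have h2 : gen 2 = 1 := rfl
  have hi : i = 0 ∨ i = 1 ∨ i = 2 := by omega
  have hj : j = 0 ∨ j = 1 ∨ j = 2 := by omega
  rcases hi with rfl | rfl | rfl <;> rcases hj with rfl | rfl | rfl
  · simp
  · rw [← neg_sub, gen_comm]; exact neg_mem h1
  · simp [h2]
  · rw [gen_comm]; exact h1
  · simp
  · simp [h2]
  · simp [h2]
  · simp [h2]
  · simp

theorem exists_eq_sum (r : WeylAlgebraOne) : ∃ (N : ℕ) (a : ℕ → ℂ[X]),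
    r = ∑ j ∈ Finset.range N, aeval (gen 0) (a j) * gen 1 ^ j := by
  obtain ⟨n, hn⟩ := weightFiltration.exists_mem gen (fun _ => 1) adjoin_gen r
  replace hn := weightFiltration.le_span_monomials (fun _ => one_pos) commutator_gen_mem n hn
  refine ⟨n + 1, ?_⟩
  induction hn using Submodule.span_induction with
  | zero => exact ⟨0, by simp⟩
  | add x y _ _ hx hy =>
    obtain ⟨a, rfl⟩ := hx
    obtain ⟨b, rfl⟩ := hy
    exact ⟨a + b, by simp only [Pi.add_apply, map_add, add_mul, Finset.sum_add_distrib]⟩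
  | smul c x _ hx =>
    obtain ⟨a, rfl⟩ := hx
    exact ⟨c • a, by simp only [Pi.smul_apply, map_smul, smul_mul_assoc, Finset.smul_sum]⟩
  | mem x hx =>
    obtain ⟨i, j, e, h, rfl⟩ := hx
    refine ⟨Pi.single j (X ^ i), ?_⟩
    rw [Finset.sum_eq_single_of_mem j (Finset.mem_range.mpr (by omega))
      fun k _ hk => by rw [Pi.single_eq_of_ne hk, map_zero, zero_mul]]
    simp [gen]

variable {R : Type*} [Ring R] [Algebra ℂ R]

/-- The homomorphism from the Weyl algebra given by a Weyl pair. -/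
noncomputable def lift (y z : R) (h : y * z - z * y = 1) : WeylAlgebraOne →ₐ[ℂ] R :=
  RingQuot.liftAlgHom ℂ ⟨FreeAlgebra.lift ℂ fun g => match g with
    | WeylGen.x => z
    | WeylGen.d => y, by
      rintro _ _ ⟨⟩
      simpa using h⟩

variable {y z : R} (h : y * z - z * y = 1)

theorem lift_gen_zero : lift y z h (gen 0) = z := by simp [lift, gen]

theorem lift_gen_one : lift y z h (gen 1) = y := by simp [lift, gen]

theorem lift_injective [Nontrivial R] : Function.Injective (lift y z h) := by
  rw [injective_iff_map_eq_zero]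
  intro r hr
  obtain ⟨N, a, rfl⟩ := exists_eq_sum r
  simp only [map_sum, map_mul, map_pow, ← aeval_algHom_apply, lift_gen_zero, lift_gen_one] at hr
  have := WeylPair.sum_eq_zero h N a hr
  exact Finset.sum_eq_zero fun j hj => by
    rw [this j (Finset.mem_range.mp hj), map_zero, zero_mul]


/-- A Weyl pair in any domain embeds the Weyl algebra there, which rules out zero divisors; growth
gives the Ore condition. -/
theorem isOreDomain [IsDomain R] (h : y * z - z * y = 1) : IsOreDomain WeylAlgebraOne :=
  have : IsDomain WeylAlgebraOne := (lift_injective h).isDomain (lift y z h).toRingHom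
  weightFiltration.isOreDomain (fun _ => one_pos) commutator_gen_mem adjoin_gen

end WeylAlgebraOne

/-! ### Skew fields of fractions inside a division ring -/

namespace SkewFrac

variable {R K : Type*} [Ring R] [IsOreDomain R] [Algebra ℂ R] [DivisionRing K] [Algebra ℂ K]

/-- The extension of an injective homomorphism to the skew field of fractions. -/
noncomputable def lift (f : R →ₐ[ℂ] K) (hf : Function.Injective f) : SkewFrac R →ₐ[ℂ] K :=
  let fS : R⁰ →* Kˣ :=
    { toFun := fun s => Units.mk0 (f s) ((map_ne_zero_iff f hf).mpr (nonZeroDivisors.ne_zero s.2))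
      map_one' := Units.ext (by simp)
      map_mul' := fun s t => Units.ext (by simp) }
  { OreLocalization.universalHom (f : R →+* K) fS (fun _ => rfl) with
    commutes' := fun r => (OreLocalization.universalHom_commutes (f : R →+* K) fS
      (fun _ => rfl)).trans (f.commutes r) }

variable {f : R →ₐ[ℂ] K} {hf : Function.Injective f}

theorem lift_oreDiv (r : R) (s : R⁰) : lift f hf (r /ₒ s) = (f s)⁻¹ * f r := by
  have hs : f s ≠ 0 := (map_ne_zero_iff f hf).mpr (nonZeroDivisors.ne_zero s.2)
  change ((Units.mk0 (f s) hs)⁻¹ : Kˣ) * f r = _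
  rw [Units.val_inv_eq_inv_val, Units.val_mk0]

theorem mem_range_lift (r : R) : f r ∈ (lift f hf).range :=
  ⟨r /ₒ 1, by
    change lift f hf (r /ₒ 1) = f r
    rw [lift_oreDiv, OneMemClass.coe_one, map_one, inv_one, one_mul]⟩

theorem inv_mem_range_lift {x : K} (hx : x ∈ (lift f hf).range) : x⁻¹ ∈ (lift f hf).range := by
  obtain ⟨y, rfl⟩ := hx
  exact ⟨y⁻¹, map_inv₀ (lift f hf) y⟩

/-- Every fraction is sent to (f s)⁻¹ f r. With the two preceding lemmas, the image is the smallest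
inverse-closed subalgebra containing the values of f, so images can be compared on generators. -/
theorem range_lift_le {B : Subalgebra ℂ K} (hB : ∀ x ∈ B, x⁻¹ ∈ B) (h : ∀ r, f r ∈ B) :
    (lift f hf).range ≤ B := by
  rintro _ ⟨x, rfl⟩
  induction x using OreLocalization.ind with
  | _ r s =>
    change lift f hf (r /ₒ s) ∈ B
    rw [lift_oreDiv]
    exact mul_mem (hB _ (h _)) (h _)

/-- Skew fields of fractions with equal images in a division ring are isomorphic. -/
noncomputable def equivOfRangeEq {R' : Type*} [Ring R'] [IsOreDomain R'] [Algebra ℂ R']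
    {g : R' →ₐ[ℂ] K} {hg : Function.Injective g} (h : (lift f hf).range = (lift g hg).range) :
    SkewFrac R ≃ₐ[ℂ] SkewFrac R' :=
  ((AlgEquiv.ofInjective (lift f hf) (lift f hf).toRingHom.injective).trans
    (Subalgebra.equivOfEq _ _ h)).trans
    (AlgEquiv.ofInjective (lift g hg) (lift g hg).toRingHom.injective).symm

end SkewFrac

theorem AlgHom.forall_mem_of_adjoin_eq_top {R A B : Type*} [CommSemiring R] [Semiring A]
    [Semiring B] [Algebra R A] [Algebra R B] (f : A →ₐ[R] B) {s : Set A}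
    (hs : Algebra.adjoin R s = ⊤) (C : Subalgebra R B) (h : ∀ x ∈ s, f x ∈ C) (x : A) :
    f x ∈ C := by
  have : Algebra.adjoin R s ≤ C.comap f := Algebra.adjoin_le h
  exact this (hs ▸ Algebra.mem_top)

theorem Polynomial.exists_even_odd {R : Type*} [CommRing R] (f : R[X]) :
    ∃ f₀ f₁ : R[X], f = f₀.comp (X ^ 2) + f₁.comp (X ^ 2) * X := by
  induction f using Polynomial.induction_on with
  | C a => exact ⟨C a, 0, by simp⟩
  | add f g hf hg =>
    obtain ⟨f₀, f₁, hf⟩ := hf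
    obtain ⟨g₀, g₁, hg⟩ := hg
    exact ⟨f₀ + g₀, f₁ + g₁, by rw [hf, hg, add_comp, add_comp]; ring⟩
  | monomial n a h =>
    obtain ⟨f₀, f₁, h⟩ := h
    exact ⟨X * f₁, f₀, by rw [pow_succ, ← mul_assoc, h, mul_comp, X_comp]; ring⟩

/-- Multiply the relation by y⁻¹ on both sides: z y⁻¹ - y⁻¹ z = 1. -/
theorem inv_mul_neg_sub_neg_mul_inv {K : Type*} [DivisionRing K] {y z : K} (hy : y ≠ 0)
    (h : y * z - z * y = y * y) : y⁻¹ * -z - -z * y⁻¹ = 1 := by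
  have h' := congrArg (fun t => y⁻¹ * t * y⁻¹) h
  simp only [mul_sub, sub_mul] at h'
  rw [inv_mul_cancel_left₀ hy, inv_mul_cancel_left₀ hy, mul_inv_cancel₀ hy, mul_assoc y⁻¹ (z * y),
    mul_inv_cancel_right₀ hy] at h'
  rw [← h', mul_neg, neg_mul]
  abel

/-! ### A Weyl pair generating the skew field of D(q) -/

namespace KleinianD

open ShiftAlgebra

/-- The difference operator `σ + σ⁻¹`. -/
noncomputable def opZ : ShiftAlgebra := penta 0 0 1 1 0

/-- The difference operator `x⁻¹ (σ - σ⁻¹)`. -/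
noncomputable def opY : ShiftAlgebra := penta 0 0 (1 / RatFun.X) (-1 / RatFun.X) 0

theorem opY_ne_zero : opY ≠ 0 := fun h => by
  have h1 := coeff_penta (1 / RatFun.X) (-1 / RatFun.X) 0
  rw [← opY, h] at h1
  exact one_div_ne_zero X_ne h1.symm

theorem opY_opZ : opY * opZ - opZ * opY = opY * opY := by
  have hx := X_ne
  have h1 := X_add_one_ne
  have h2 := X_sub_one_ne
  rw [opY, opZ]
  simp only [penta_mul_penta, penta_sub, map_div₀, map_neg, map_one, map_zero, ratShift_X,
    Int.cast_one, Int.cast_neg, ← sub_eq_add_neg]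
  congr 1 <;> field_simp <;> ring

/-- The square of xY = σ - σ⁻¹ is Z² - 4, and Yx - xY = x⁻¹ Z, so Z² - 4 = xYxY = x²Y² + ZY. This
makes u a rational expression in Y and Z. -/
theorem opU_opY_opY : opU * opY * opY = opZ * opZ - 4 - opZ * opY := by
  have hx := X_ne
  have h1 := X_add_one_ne
  have h2 := X_sub_one_ne
  rw [show (4 : ShiftAlgebra) = const 4 from (map_ofNat const 4).symm, const_eq_penta, opY, opZ,
    opU, ← const_eq_penta, const_mul_penta, mul_zero]
  simp only [penta_mul_penta, penta_sub, map_div₀, map_neg, map_one, map_zero, ratShift_X,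
    Int.cast_one, Int.cast_neg, ← sub_eq_add_neg]
  congr 1 <;> field_simp <;> ring

theorem four_opU_sub_one : 4 * opU - 1 = penta 0 0 0 0 (4 * RatFun.X ^ 2 - 1) := by
  rw [opU, ← const_eq_penta, ← const_eq_penta, map_sub, map_mul, map_ofNat, map_one]

variable {q h₀ h₁ : ℂ[X]}

theorem aeval_even_odd (h : q * (2 * X - 1) = h₀.comp (X ^ 2) + h₁.comp (X ^ 2) * X)
    (f : RatFun) : aeval f q * (2 * f - 1) = aeval (f ^ 2) h₀ + aeval (f ^ 2) h₁ * f := by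
  simpa [aeval_comp, map_ofNat] using congrArg (aeval f) h

/-- The factor 4x² - 1 turns A into q(x)(2x-1)/x = h₁(x²) + h₀(x²)/x and B into h₁(x²) - h₀(x²)/x,
the coefficients of h₁Z + h₀Y, and turns G into -2ρ. -/
theorem opV_eq (h : q * (2 * X - 1) = h₀.comp (X ^ 2) + h₁.comp (X ^ 2) * X) :
    (4 * opU - 1) * opV q + algebraMap ℂ _ (2 * rho q)
      = aeval opU h₁ * opZ + aeval opU h₀ * opY := by
  have hx := X_ne
  have h3 := two_X_add_one_ne
  have h4 := two_X_sub_one_ne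
  have h3' := h3
  have h4' := h4
  rw [mul_comm] at h3' h4'
  have e1 := aeval_even_odd h RatFun.X
  have e2 := aeval_even_odd h (-RatFun.X)
  rw [neg_sq] at e2
  rw [four_opU_sub_one, aeval_opU, aeval_opU, algebraMap_eq_penta, opV, opY, opZ]
  simp only [← const_eq_penta, const_mul_penta]
  rw [const_eq_penta, penta_add, penta_add]
  congr 1
  · ring
  · ring
  · rw [coeffA]; field_simp; linear_combination (2 * RatFun.X + 1) * e1
  · rw [coeffB]; field_simp; linear_combination -(2 * RatFun.X - 1) * e2
  · rw [coeffG_eq, map_mul, map_ofNat]; field_simp; ring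

/-- Adding v to w makes the coefficients -xA and xB, so the extra factor x exchanges the even and
odd parts of q(x)(2x-1). -/
theorem opW_eq (h : q * (2 * X - 1) = h₀.comp (X ^ 2) + h₁.comp (X ^ 2) * X) :
    (4 * opU - 1) * (opW q + opV q) + algebraMap ℂ _ (rho q)
      = -(aeval opU h₀ * opZ) - opU * aeval opU h₁ * opY := by
  have hx := X_ne
  have h3 := two_X_add_one_ne
  have h4 := two_X_sub_one_ne
  have h3' := h3
  have h4' := h4
  rw [mul_comm] at h3' h4'
  have e1 := aeval_even_odd h RatFun.X
  have e2 := aeval_even_odd h (-RatFun.X)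
  rw [neg_sq] at e2
  rw [four_opU_sub_one, aeval_opU, aeval_opU, algebraMap_eq_penta, opV, opW, penta_add, opY, opZ,
    opU]
  simp only [← const_eq_penta, ← map_mul, const_mul_penta]
  rw [const_eq_penta, penta_add, penta_neg, penta_sub]
  congr 1
  · ring
  · ring
  · rw [coeffA]; field_simp; linear_combination -RatFun.X * (2 * RatFun.X + 1) * e1
  · rw [coeffB]; field_simp; linear_combination -RatFun.X * (2 * RatFun.X - 1) * e2
  · rw [coeffG_eq]; field_simp; ring

theorem four_opU_sub_one_ne_zero : 4 * opU - 1 ≠ 0 := fun h => by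
  have h1 := coeff_penta_zero (4 * RatFun.X ^ 2 - 1)
  rw [← four_opU_sub_one, h] at h1
  refine one_sub_ne ?_
  rw [← neg_sub, neg_eq_zero]
  exact h1.symm

/-- At x² the determinant factors as (h₀ + h₁x)(h₀ - h₁x) = q(x)(2x-1) · q(-x)(-2x-1). -/
theorem aeval_opU_det_ne_zero (hq : q ≠ 0)
    (h : q * (2 * X - 1) = h₀.comp (X ^ 2) + h₁.comp (X ^ 2) * X) :
    aeval opU (h₀ ^ 2 - X * h₁ ^ 2) ≠ 0 := fun h0 => by
  have h1 := coeff_aeval_opU (h₀ ^ 2 - X * h₁ ^ 2)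
  rw [h0] at h1
  have e1 := aeval_even_odd h RatFun.X
  have e2 := aeval_even_odd h (-RatFun.X)
  rw [neg_sq] at e2
  have hne : ∀ f : RatFun, Function.Injective (aeval f : ℂ[X] →ₐ[ℂ] RatFun) →
      aeval f q ≠ 0 := fun f hf => (map_ne_zero_iff _ hf).mpr hq
  have hinj : Function.Injective (aeval RatFun.X : ℂ[X] →ₐ[ℂ] RatFun) := fun a b hab => by
    rw [RatFun.X, aeval_algebraMap_apply, aeval_algebraMap_apply, aeval_X_left_apply,
      aeval_X_left_apply] at hab
    exact IsFractionRing.injective ℂ[X] RatFun hab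
  have hinj' : Function.Injective (aeval (-RatFun.X) : ℂ[X] →ₐ[ℂ] RatFun) := fun a b hab => by
    have hcomp : ∀ c : ℂ[X], aeval (-RatFun.X) c = aeval RatFun.X (c.comp (-X)) := fun c => by
      rw [aeval_comp, map_neg, aeval_X]
    rw [hcomp, hcomp] at hab
    have := congrArg (fun c => c.comp (-X)) (hinj hab)
    simpa [comp_assoc] using this
  have h4 : 2 * -RatFun.X - 1 ≠ 0 := by
    rw [show 2 * -RatFun.X - 1 = -(2 * RatFun.X + 1) by ring]
    exact neg_ne_zero.mpr two_X_add_one_ne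
  refine mul_ne_zero (mul_ne_zero (hne _ hinj) two_X_sub_one_ne)
    (mul_ne_zero (hne _ hinj') h4) ?_
  rw [e1, e2]
  simp only [map_sub, map_mul, map_pow, aeval_X] at h1
  refine Eq.trans ?_ h1.symm
  ring

/-- The inverse of `x⁻¹ (σ - σ⁻¹)` and `-(σ + σ⁻¹)` form a Weyl pair. -/
theorem weylPair : (ShiftField.of opY)⁻¹ * -ShiftField.of opZ
    - -ShiftField.of opZ * (ShiftField.of opY)⁻¹ = 1 := by
  have h0 : ShiftField.of opY ≠ 0 := (map_ne_zero_iff _ ShiftField.of_injective).mpr opY_ne_zero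
  have h := congrArg ShiftField.of opY_opZ
  rw [map_sub, map_mul, map_mul, map_mul] at h
  exact inv_mul_neg_sub_neg_mul_inv h0 h

/-- The homomorphism from the Weyl algebra to the skew field of difference operators. -/
noncomputable def weylRep : WeylAlgebraOne →ₐ[ℂ] ShiftField := WeylAlgebraOne.lift _ _ weylPair

theorem weylRep_gen_zero : weylRep (WeylAlgebraOne.gen 0) = -ShiftField.of opZ :=
  WeylAlgebraOne.lift_gen_zero weylPair

theorem weylRep_gen_one : weylRep (WeylAlgebraOne.gen 1) = (ShiftField.of opY)⁻¹ :=
  WeylAlgebraOne.lift_gen_one weylPair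

theorem weylRep_injective : Function.Injective weylRep := WeylAlgebraOne.lift_injective weylPair

theorem weylAlgebraOne_isOreDomain : IsOreDomain WeylAlgebraOne :=
  WeylAlgebraOne.isOreDomain weylPair

theorem mem_of_mul_mem {B : Subalgebra ℂ ShiftField} (hB : ∀ x ∈ B, x⁻¹ ∈ B) {x y : ShiftField}
    (hx : x ∈ B) (hx0 : x ≠ 0) (h : x * y ∈ B) : y ∈ B := by
  rw [← inv_mul_cancel_left₀ hx0 y]
  exact mul_mem (hB x hx) h

theorem aeval_mem {B : Subalgebra ℂ ShiftField} {f : ShiftAlgebra} (hf : ShiftField.of f ∈ B)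
    (a : ℂ[X]) : ShiftField.of (aeval f a) ∈ B := by
  rw [← aeval_algHom_apply]
  exact Algebra.adjoin_le (Set.singleton_subset_iff.mpr hf) (aeval_mem_adjoin_singleton ℂ _)

theorem four_opU_sub_one_mem {B : Subalgebra ℂ ShiftField} (hu : ShiftField.of opU ∈ B) :
    ShiftField.of (4 * opU - 1) ∈ B := by
  have e : aeval opU (4 * X - 1 : ℂ[X]) = 4 * opU - 1 := by
    rw [map_sub, map_mul, map_ofNat, aeval_X, map_one]
  exact e ▸ aeval_mem hu (4 * X - 1)

theorem opU_opV_opW_mem {B : Subalgebra ℂ ShiftField} (hB : ∀ x ∈ B, x⁻¹ ∈ B)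
    (hy : ShiftField.of opY ∈ B) (hz : ShiftField.of opZ ∈ B) :
    ShiftField.of opU ∈ B ∧ ShiftField.of (opV q) ∈ B ∧ ShiftField.of (opW q) ∈ B := by
  have hy0 : ShiftField.of opY ≠ 0 := (map_ne_zero_iff _ ShiftField.of_injective).mpr opY_ne_zero
  have hu : ShiftField.of opU ∈ B := by
    have h := congrArg ShiftField.of opU_opY_opY
    simp only [map_mul, map_sub, map_ofNat] at h
    have h4 : (4 : ShiftField) ∈ B := by exact_mod_cast natCast_mem B 4
    have h' : ShiftField.of opU * ShiftField.of opY * ShiftField.of opY ∈ B :=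
      h ▸ sub_mem (sub_mem (mul_mem hz hz) h4) (mul_mem hz hy)
    -- u = (Z² - 4 - ZY) Y⁻².
    have := mul_mem (mul_mem h' (hB _ hy)) (hB _ hy)
    rwa [mul_inv_cancel_right₀ hy0, mul_inv_cancel_right₀ hy0] at this
  obtain ⟨h₀, h₁, h⟩ := Polynomial.exists_even_odd (q * (2 * X - 1))
  have h4 := four_opU_sub_one_mem hu
  have h40 : ShiftField.of (4 * opU - 1) ≠ 0 :=
    (map_ne_zero_iff _ ShiftField.of_injective).mpr four_opU_sub_one_ne_zero
  have hv : ShiftField.of (opV q) ∈ B := by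
    refine mem_of_mul_mem hB h4 h40 ?_
    rw [← map_mul, eq_sub_of_add_eq (opV_eq h), map_sub, map_add, map_mul, map_mul,
      AlgHom.commutes]
    exact sub_mem (add_mem (mul_mem (aeval_mem hu _) hz) (mul_mem (aeval_mem hu _) hy))
      (algebraMap_mem B _)
  refine ⟨hu, hv, ?_⟩
  have hvw : ShiftField.of (opW q + opV q) ∈ B := by
    refine mem_of_mul_mem hB h4 h40 ?_
    rw [← map_mul, eq_sub_of_add_eq (opW_eq h), map_sub, map_sub, map_neg, map_mul, map_mul,
      map_mul, AlgHom.commutes]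
    exact sub_mem (sub_mem (neg_mem (mul_mem (aeval_mem hu _) hz))
      (mul_mem (mul_mem hu (aeval_mem hu _)) hy)) (algebraMap_mem B _)
  rw [map_add] at hvw
  simpa using sub_mem hvw hv

theorem opY_opZ_mem (hq : q ≠ 0) {B : Subalgebra ℂ ShiftField} (hB : ∀ x ∈ B, x⁻¹ ∈ B)
    (hu : ShiftField.of opU ∈ B) (hv : ShiftField.of (opV q) ∈ B)
    (hw : ShiftField.of (opW q) ∈ B) : ShiftField.of opY ∈ B ∧ ShiftField.of opZ ∈ B := by
  obtain ⟨h₀, h₁, h⟩ := Polynomial.exists_even_odd (q * (2 * X - 1))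
  have h4 := four_opU_sub_one_mem hu
  have hα : ShiftField.of (aeval opU h₁ * opZ + aeval opU h₀ * opY) ∈ B := by
    rw [← opV_eq h, map_add, map_mul, AlgHom.commutes]
    exact add_mem (mul_mem h4 hv) (algebraMap_mem B _)
  have hβ : ShiftField.of (-(aeval opU h₀ * opZ) - opU * aeval opU h₁ * opY) ∈ B := by
    rw [← opW_eq h, map_add, map_mul, AlgHom.commutes, map_add]
    exact add_mem (mul_mem h4 (add_mem hw hv)) (algebraMap_mem B _)
  have hδ0 := (map_ne_zero_iff _ ShiftField.of_injective).mpr (aeval_opU_det_ne_zero hq h)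
  have hδ := aeval_mem hu (h₀ ^ 2 - X * h₁ ^ 2)
  have hcomm : aeval opU h₀ * aeval opU h₁ = aeval opU h₁ * aeval opU h₀ := by
    rw [← map_mul, mul_comm, map_mul]
  have hcomm' : aeval opU h₀ * (opU * aeval opU h₁) = opU * aeval opU h₁ * aeval opU h₀ := by
    have := congrArg (aeval opU) (mul_comm h₀ (X * h₁))
    simpa using this
  constructor
  · refine mem_of_mul_mem hB hδ hδ0 ?_
    -- Cramer's rule for the system in `opV_eq` and `opW_eq`, here and for Z below; it applies
    -- because the coefficients stand on the left and commute, being polynomials in u.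
    have e : aeval opU (h₀ ^ 2 - X * h₁ ^ 2) * opY
        = aeval opU h₀ * (aeval opU h₁ * opZ + aeval opU h₀ * opY)
          + aeval opU h₁ * (-(aeval opU h₀ * opZ) - opU * aeval opU h₁ * opY) := by
      have e' : aeval opU h₁ * (opU * aeval opU h₁) = opU * aeval opU h₁ ^ 2 := by
        have := congrArg (aeval opU) (show h₁ * (X * h₁) = X * h₁ ^ 2 by ring)
        simpa using this
      rw [mul_add, mul_sub, mul_neg, ← mul_assoc, ← mul_assoc, ← mul_assoc, ← mul_assoc, hcomm, e']
      simp only [map_sub, map_mul, aeval_X, sq]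
      noncomm_ring
    rw [← map_mul, e, map_add, map_mul, map_mul]
    exact add_mem (mul_mem (aeval_mem hu _) hα) (mul_mem (aeval_mem hu _) hβ)
  · refine mem_of_mul_mem hB hδ hδ0 ?_
    have e : aeval opU (h₀ ^ 2 - X * h₁ ^ 2) * opZ
        = -(opU * aeval opU h₁ * (aeval opU h₁ * opZ + aeval opU h₀ * opY)
          + aeval opU h₀ * (-(aeval opU h₀ * opZ) - opU * aeval opU h₁ * opY)) := by
      rw [mul_add, mul_sub, mul_neg, ← mul_assoc, ← mul_assoc, ← mul_assoc (aeval opU h₀),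
        ← mul_assoc (aeval opU h₀), hcomm']
      simp only [map_sub, map_mul, aeval_X, sq]
      noncomm_ring
    rw [← map_mul, e, map_neg, map_add, map_mul, map_mul, map_mul]
    exact neg_mem (add_mem (mul_mem (mul_mem hu (aeval_mem hu _)) hα)
      (mul_mem (aeval_mem hu _) hβ))

end KleinianD

theorem mainTheorem6 (q : ℂ[X]) (hq : 4 ≤ q.natDegree) :
    ∃ (_ : IsOreDomain (KleinianDAlgebra q)) (_ : IsOreDomain WeylAlgebraOne),
      Nonempty (SkewFrac (KleinianDAlgebra q) ≃ₐ[ℂ] SkewFrac WeylAlgebraOne) := by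
  have hq0 : q ≠ 0 := by
    rintro rfl
    simp at hq
  refine ⟨KleinianD.isOreDomain hq0, KleinianD.weylAlgebraOne_isOreDomain, ?_⟩
  have := KleinianD.isOreDomain hq0
  have := KleinianD.weylAlgebraOne_isOreDomain
  let f : KleinianDAlgebra q →ₐ[ℂ] ShiftField := ShiftField.of.comp (KleinianD.rep q)
  have hf : Function.Injective f := ShiftField.of_injective.comp (KleinianD.rep_injective hq0)
  -- Both skew fields of fractions embed in `ShiftField`; each inclusion between their images is
  -- checked on the generators of one algebra.
  refine ⟨SkewFrac.equivOfRangeEq (hf := hf) (hg := KleinianD.weylRep_injective)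
    (le_antisymm ?_ ?_)⟩
  · refine SkewFrac.range_lift_le (fun _ => SkewFrac.inv_mem_range_lift)
      (AlgHom.forall_mem_of_adjoin_eq_top f (KleinianD.adjoin_gen q) _ ?_)
    have h0 := SkewFrac.mem_range_lift (hf := KleinianD.weylRep_injective) (WeylAlgebraOne.gen 0)
    have h1 := SkewFrac.mem_range_lift (hf := KleinianD.weylRep_injective) (WeylAlgebraOne.gen 1)
    rw [KleinianD.weylRep_gen_zero, neg_mem_iff] at h0
    rw [KleinianD.weylRep_gen_one] at h1
    replace h1 := SkewFrac.inv_mem_range_lift h1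
    rw [inv_inv] at h1
    obtain ⟨hu, hv, hw⟩ := KleinianD.opU_opV_opW_mem (q := q)
      (fun _ => SkewFrac.inv_mem_range_lift) h1 h0
    rintro _ ⟨i, rfl⟩
    have hi : i = 0 ∨ i = 1 ∨ i = 2 := by omega
    rcases hi with rfl | rfl | rfl
    · rwa [AlgHom.comp_apply, KleinianD.rep_u]
    · rwa [AlgHom.comp_apply, KleinianD.rep_v]
    · rwa [AlgHom.comp_apply, KleinianD.rep_w]
  · refine SkewFrac.range_lift_le (fun _ => SkewFrac.inv_mem_range_lift)
      (AlgHom.forall_mem_of_adjoin_eq_top KleinianD.weylRep WeylAlgebraOne.adjoin_gen _ ?_)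
    have h0 := SkewFrac.mem_range_lift (hf := hf) (KleinianD.gen q 0)
    have h1 := SkewFrac.mem_range_lift (hf := hf) (KleinianD.gen q 1)
    have h2 := SkewFrac.mem_range_lift (hf := hf) (KleinianD.gen q 2)
    rw [AlgHom.comp_apply, KleinianD.rep_u] at h0
    rw [AlgHom.comp_apply, KleinianD.rep_v] at h1
    rw [AlgHom.comp_apply, KleinianD.rep_w] at h2
    obtain ⟨hy, hz⟩ := KleinianD.opY_opZ_mem hq0 (fun _ => SkewFrac.inv_mem_range_lift) h0 h1 h2
    rintro _ ⟨i, rfl⟩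
    have hi : i = 0 ∨ i = 1 ∨ i = 2 := by omega
    rcases hi with rfl | rfl | rfl
    · rw [KleinianD.weylRep_gen_zero]
      exact neg_mem hz
    · rw [KleinianD.weylRep_gen_one]
      exact SkewFrac.inv_mem_range_lift hy
    · exact (map_one KleinianD.weylRep).symm ▸ one_mem _
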